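/- **Conventions.** $n$ is the security parameter; a function $\epsilon(n)$ is negligible if it tends to $0$ faster than every inverse polynomial. A random variable is $\epsilon$-close to another if the variational distance $\sum_x|\Pr[X=x]-\Pr[Y=x]|$ is at most $\epsilon$. $A(x;r)$ denotes algorithm $A$ run on input $x$ with random coins $r$. PPT means probabilistic polynomial time in $n$. **PSF.** A preimage sampleable trapdoor function $\mathcal F=(G,\mathrm{Sample},f,f^{-1})$ consists of PPT algorithms, where $f$ is deterministic, and finite sets $D=D_n$, $R=R_n$ of bit strings of lengths depending on $n$, such that for all key pairs $(\mathsf{sk},\mathsf{pk})$ generated by $G(1^n)$: (i) $f(\mathsf{pk},\cdot)$ maps $D$ to $R$; (ii) $\mathrm{Sample}(1^n)$ outputs elements of $D$, and $f(\mathsf{pk},\mathrm{Sample}(1^n))$ is $\epsilon_{\rm sample}$-close to uniform on $R$; (iii) for $y\in R$, $f^{-1}(\mathsf{sk},y)$ always outputs some $x\in D$ with $f(\mathsf{pk},x)=y$, and, if $\Pr[f(\mathsf{pk},\mathrm{Sample}(1^n))=y]>0$, its output is $\epsilon_{\rm pre}$-close to $\mathrm{Sample}(1^n)$ conditioned on $f(\mathsf{pk},\mathrm{Sample}(1^n))=y$;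 (iv) in every such conditional distribution each element has probability at most $\epsilon_{\rm prob}$. Here $\epsilon_{\rm sample},\epsilon_{\rm pre},\epsilon_{\rm prob}$ are negligible functions of $n$. **FDH-PSF.** Let $\ell$ be a polynomial. Messages are strings $m\in\{0,1\}^{\ell(n)}$, the random oracle $O$ is a uniformly random function $\{0,1\}^{\ell(n)}\to R$, keys are generated by $G$, $S^O(\mathsf{sk},m)=f^{-1}(\mathsf{sk},O(m))$ where the coins of $f^{-1}$ are a private random function of $m$ (so a repeated query gets the same signature), and $V^O(\mathsf{pk},m,\sigma)=1$ iff $\sigma\in D$ and $f(\mathsf{pk},\sigma)=O(m)$. **Collision problem** $\mathrm{Col}(\mathcal F)$. The challenger sends $\mathsf{pk}$ from $(\mathsf{sk},\mathsf{pk})\leftarrow G(1^n)$ and accepts $(x_1,x_2)$ iff $x_1,x_2\in D$, $x_1\ne x_2$ and $f(\mathsf{pk},x_1)=f(\mathsf{pk},x_2)$. **Reduction.** Let $O_c$ be a uniformly random function from $\{0,1\}^{\ell(n)}$ to the coins of $\mathrm{Sample}(1^n)$. Put $\mathrm{START}(\mathsf{pk})=(\mathsf{pk},\mathsf{pk})$,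 $\mathrm{INSTANCE}(\mathsf{pk})=\mathsf{pk}$, $\mathrm{RAND}^{O_c}(r,\mathsf{pk})=f(\mathsf{pk},\mathrm{Sample}(1^n;O_c(r)))$, $\mathrm{SIGN}^{O_c}(m,\mathsf{pk})=\mathrm{Sample}(1^n;O_c(m))$, $\mathrm{FINISH}^{O_c}(m,\sigma,\mathsf{pk})=(\mathrm{Sample}(1^n;O_c(m)),\sigma)$. From an adversary $A$ against FDH-PSF one obtains the collision finder $B$: on input $x$ compute $(\mathsf{pk},z)=\mathrm{START}(x)$, run $A(\mathsf{pk})$, answer its hash queries $r$ by $\mathrm{RAND}^{O_c}(r,z)$ and its signature queries $m$ by $\mathrm{SIGN}^{O_c}(m,z)$, aborting if $\mathrm{SIGN}$ aborts, and when $A$ outputs $(m,\sigma)$ output $\mathrm{FINISH}^{O_c}(m,\sigma,z)$. **Theorem.** For every PSF $\mathcal F$ and every polynomial $\ell$, this reduction from $\mathrm{Col}(\mathcal F)$ to forging FDH-PSF signatures is history-free, that is: 1. START, RAND, SIGN, FINISH and INSTANCE are polynomial-time algorithms (RAND, SIGN, FINISH relative to $O_c$); for every classical PPT adversary $A$, $B$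 is a classical PPT algorithm relative to $O_c$; and if $A$ produces, in the chosen message attack game for FDH-PSF in the random oracle model, a valid signature of a message whose signature it did not ask for with non-negligible probability, then $B$ wins the game of $\mathrm{Col}(\mathcal F)$ with non-negligible probability. 2. For every $\mathsf{pk}$, $\mathrm{START}(\mathrm{INSTANCE}(\mathsf{pk}))=(\mathsf{pk},z)$ for some $z$; and for $(\mathsf{sk},\mathsf{pk})\leftarrow G(1^n)$, $\mathrm{INSTANCE}(\mathsf{pk})$ is negligibly close in distribution to the instance in the game of $\mathrm{Col}(\mathcal F)$. 3. For every fixed sequence of states $z=z_n$ that START produces from instances of $\mathrm{Col}(\mathcal F)$, the quantum oracle $|x,y\rangle\mapsto|x,y\oplus \mathrm{RAND}^{O_c}(x,z)\rangle$, with $O_c$ random, is indistinguishable from $|x,y\rangle\mapsto|x,y\oplus O(x)\rangle$, with $O$ a random oracle with values in $R$: for every quantum algorithm given by circuits of polynomially many Hadamard, phase, $\pi/8$, CNOT and oracle gates on polynomially many qubits, the variational distance of its output distributions with the two oracles is negligible. 4. For all $(\mathsf{sk},\mathsf{pk})$ generated by $G(1^n)$ and $(\mathsf{pk},z)=\mathrm{START}(\mathrm{INSTANCE}(\mathsf{pk}))$: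 whenever $\mathrm{SIGN}^{O_c}(m,z)$ does not abort, it is a valid signature of $m$ under $\mathsf{pk}$ relative to the oracle $O(r)=\mathrm{RAND}^{O_c}(r,z)$. Moreover, there is a negligible $\epsilon(n)$ such that for every set $M$ of messages, conditioned on SIGN not aborting on $M$, the joint distributions of $(O,(\mathrm{SIGN}^{O_c}(m,z))_{m\in M})$ and $(O,(S^{O}(\mathsf{sk},m))_{m\in M})$, where $O(r)=\mathrm{RAND}^{O_c}(r,z)$, have variational distance at most $|M|\,\epsilon(n)$. For every classical PPT adversary $A$ run by $B$, the probability that none of its signature queries abort is non-negligible. 5. For every classical PPT adversary $A$ run by $B$ there is a non-negligible $\delta(n)\ge 0$ such that $\Pr[A\text{ outputs a valid forgery and the challenger accepts } B\text{'s output}]\ge\delta(n)\Pr[A\text{ outputs a valid forgery}]$, where $B$ has not aborted and a valid forgery $(m,\sigma)$ is a valid signature relative to $\mathsf{pk}$ and $O(r)=\mathrm{RAND}^{O_c}(r,z)$ of a message $m$ for which $A$ did not ask for a signature. -/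

import Mathlib

/-! ### Negligible functions, bit strings, finite probability -/

/-- A function of the security parameter is negligible if it decays faster than every inverse
polynomial. -/
def Negligible (ε : ℕ → ℝ) : Prop :=
  Asymptotics.SuperpolynomialDecay Filter.atTop (fun n : ℕ => (n : ℝ)) ε

/-- Bit strings of length `k`. -/
abbrev Bits (k : ℕ) : Type := Fin k → Bool

/-- Bit strings of arbitrary length, the data on which programs work. -/
abbrev Str : Type := List Bool

open scoped Classical in
/-- Probability of the event `E` when `ω` is drawn uniformly from the finite set `Ω`. -/
noncomputable def prob {Ω : Type} [Fintype Ω] (E : Ω → Prop) : ℝ :=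
  ((Finset.univ.filter E).card : ℝ) / (Fintype.card Ω : ℝ)

/-! ### Classical algorithms

A structured programming language on registers holding bit strings (stacks), with oracle calls and
calls of subprograms on a fresh set of registers, and with a step count. -/

/-- Programs. -/
inductive Cmd : Type
  /-- do nothing -/
  | skip : Cmd
  /-- push the bit `b` on register `x` -/
  | push (b : Bool) (x : ℕ) : Cmd
  /-- drop the first bit of register `x` (if there is one) -/
  | pop (x : ℕ) : Cmd
  /-- copy register `x` to register `y` -/
  | copy (x y : ℕ) : Cmd
  /-- send the content of register `x` to the oracle number `k`, store the answer in `y` -/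
  | query (k x y : ℕ) : Cmd
  /-- first `c`, then `d` -/
  | seq (c d : Cmd) : Cmd
  /-- branch on register `x`: empty, first bit `false`, first bit `true` -/
  | branch (x : ℕ) (c d e : Cmd) : Cmd
  /-- while register `x` is nonempty, do `c` -/
  | loop (x : ℕ) (c : Cmd) : Cmd
  /-- run `c` on fresh registers, where for each `(v, u)` in `args` the fresh register `v` starts
  with the content of `u`; store the content of its register `0` in `y` -/
  | call (c : Cmd) (args : List (ℕ × ℕ)) (y : ℕ) : Cmd

/-- Register contents. -/
abbrev Store : Type := ℕ → Str

/-- The store in which the registers `0, 1, 2, …` hold the given inputs; the others are empty. -/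
def inputStore (ins : List Str) : Store := fun i => ins.getD i []

/-- The fresh store of a subprogram call. -/
def callStore (s : Store) (args : List (ℕ × ℕ)) : Store :=
  args.foldl (fun s' p => Function.update s' p.1 (s p.2)) (fun _ => [])

/-- `Eval O c s s' t tr`: with the oracles `O 0, O 1, …`, the program `c` started on the store `s`
halts with the store `s'` after `t` steps, and `tr` lists the oracle queries made, in order
(number of the oracle, query).  Copying, querying an oracle and passing arguments cost as many
steps as the strings moved are long. -/
inductive Eval (O : ℕ → Str → Str) : Cmd → Store → Store → ℕ → List (ℕ × Str) → Prop
  | skip (s : Store) : Eval O .skip s s 1 []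
  | push (b : Bool) (x : ℕ) (s : Store) :
      Eval O (.push b x) s (Function.update s x (b :: s x)) 1 []
  | pop (x : ℕ) (s : Store) :
      Eval O (.pop x) s (Function.update s x (s x).tail) 1 []
  | copy (x y : ℕ) (s : Store) :
      Eval O (.copy x y) s (Function.update s y (s x)) ((s x).length + 1) []
  | query (k x y : ℕ) (s : Store) :
      Eval O (.query k x y) s (Function.update s y (O k (s x)))
        ((s x).length + (O k (s x)).length + 1) [(k, s x)]
  | seq {c d : Cmd} {s s₁ s₂ : Store} {t₁ t₂ : ℕ} {tr₁ tr₂ : List (ℕ × Str)} :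
      Eval O c s s₁ t₁ tr₁ → Eval O d s₁ s₂ t₂ tr₂ →
      Eval O (.seq c d) s s₂ (t₁ + t₂) (tr₁ ++ tr₂)
  | branch_nil {x : ℕ} {c d e : Cmd} {s s' : Store} {t : ℕ} {tr : List (ℕ × Str)} :
      s x = [] → Eval O c s s' t tr → Eval O (.branch x c d e) s s' (t + 1) tr
  | branch_false {x : ℕ} {c d e : Cmd} {s s' : Store} {t : ℕ} {tr : List (ℕ × Str)} :
      (s x).head? = some false → Eval O d s s' t tr →
      Eval O (.branch x c d e) s s' (t + 1) tr
  | branch_true {x : ℕ} {c d e : Cmd} {s s' : Store} {t : ℕ} {tr : List (ℕ × Str)} :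
      (s x).head? = some true → Eval O e s s' t tr →
      Eval O (.branch x c d e) s s' (t + 1) tr
  | loop_done {x : ℕ} {c : Cmd} {s : Store} : s x = [] → Eval O (.loop x c) s s 1 []
  | loop_step {x : ℕ} {c : Cmd} {s s₁ s₂ : Store} {t₁ t₂ : ℕ} {tr₁ tr₂ : List (ℕ × Str)} :
      s x ≠ [] → Eval O c s s₁ t₁ tr₁ → Eval O (.loop x c) s₁ s₂ t₂ tr₂ →
      Eval O (.loop x c) s s₂ (t₁ + t₂ + 1) (tr₁ ++ tr₂)
  | call {c : Cmd} {args : List (ℕ × ℕ)} {y : ℕ} {s s' : Store} {t : ℕ} {tr : List (ℕ × Str)} :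
      Eval O c (callStore s args) s' t tr →
      Eval O (.call c args y) s (Function.update s y (s' 0))
        (t + (args.map fun p => (s p.2).length).sum + (s' 0).length + 1) tr

/-- A function on bit strings of length `a`, as an oracle (malformed queries get the empty
answer). -/
def fnOracle {a b : ℕ} (g : Bits a → Bits b) : Str → Str := fun s =>
  if h : s.length = a then List.ofFn (g fun i => s.get (i.cast h.symm)) else []

/-- Access to one oracle. -/
def oneOracle {a b : ℕ} (g : Bits a → Bits b) : ℕ → Str → Str
  | 0 => fnOracle g
  | _ => fun _ => []

/-- Access to two oracles. -/
def twoOracles {a b a' b' : ℕ} (g : Bits a → Bits b) (h : Bits a' → Bits b') : ℕ → Str → Str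
  | 0 => fnOracle g
  | 1 => fnOracle h
  | _ => fun _ => []

/-- The task family `input n i ↦ output n i` (`i : ι n`) is solved, with access to the oracles
`oracle n i`, by one program that gets `1ⁿ` and the inputs, and that runs in time polynomial in the
security parameter `n`.  Random coins of an algorithm are one of its inputs. -/
def OraclePolyTime {ι : ℕ → Type} (oracle : ∀ n, ι n → ℕ → Str → Str)
    (input : ∀ n, ι n → List Str) (output : ∀ n, ι n → Str) : Prop :=
  ∃ (c : Cmd) (p : Polynomial ℕ), ∀ (n : ℕ) (i : ι n), ∃ (s : Store) (t : ℕ) (tr : List (ℕ × Str)),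
    Eval (oracle n i) c (inputStore (List.replicate n true :: input n i)) s t tr ∧
      t ≤ p.eval n ∧ s 0 = output n i

/-- Polynomial time without oracles: the program works whatever the oracles answer. -/
def PolyTime {ι : ℕ → Type} (input : ∀ n, ι n → List Str) (output : ∀ n, ι n → Str) : Prop :=
  OraclePolyTime (ι := fun n => (ℕ → Str → Str) × ι n)
    (fun _ i => i.1) (fun n i => input n i.2) (fun n i => output n i.2)

/-- Encoding of an output that may be "abort". -/
def encOption {k : ℕ} : Option (Bits k) → Str
  | none => [false]
  | some y => true :: List.ofFn y

/-! ### Quantum algorithms with quantum access to a function `{0,1}^a → {0,1}^b` -/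

/-- The qubits: `a` query qubits, `b` answer qubits, `w` work qubits. -/
abbrev Wire (a b w : ℕ) : Type := Fin a ⊕ Fin b ⊕ Fin w

/-- State vectors, in the computational basis. -/
abbrev QState (a b w : ℕ) : Type := (Wire a b w → Bool) → ℂ

/-- The universal gate set Hadamard, phase, `π/8`, CNOT, and the oracle gate. -/
inductive QGate (a b w : ℕ) : Type
  | hadamard (i : Wire a b w) : QGate a b w
  | phase (i : Wire a b w) : QGate a b w
  | piEighth (i : Wire a b w) : QGate a b w
  | cnot (c t : Wire a b w) (h : c ≠ t) : QGate a b w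
  | oracle : QGate a b w

/-- The map `|x, y, u⟩ ↦ |x, y ⊕ O(x), u⟩` on basis states. -/
def xorAnswer {a b w : ℕ} (O : Bits a → Bits b) (s : Wire a b w → Bool) : Wire a b w → Bool
  | .inl i => s (.inl i)
  | .inr (.inl j) => xor (s (.inr (.inl j))) (O (fun i => s (.inl i)) j)
  | .inr (.inr k) => s (.inr (.inr k))

/-- The unitary of a gate, acting on amplitudes (the basis permutations of CNOT and of the oracle
gate are involutions). -/
noncomputable def QGate.apply {a b w : ℕ} (O : Bits a → Bits b) :
    QGate a b w → QState a b w → QState a b w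
  | .hadamard i, ψ => fun s =>
      ((Real.sqrt 2 : ℝ) : ℂ)⁻¹ * (ψ (Function.update s i false) +
        (if s i then -1 else 1) * ψ (Function.update s i true))
  | .phase i, ψ => fun s => (if s i then Complex.I else 1) * ψ s
  | .piEighth i, ψ => fun s => (if s i then Complex.exp (Complex.I * Real.pi / 4) else 1) * ψ s
  | .cnot c t _, ψ => fun s => ψ (Function.update s t (xor (s t) (s c)))
  | .oracle, ψ => fun s => ψ (xorAnswer O s)

/-- The final state of a circuit started on `|0…0⟩`. -/
noncomputable def finalState {a b w : ℕ} (circ : List (QGate a b w)) (O : Bits a → Bits b) :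
    QState a b w :=
  circ.foldl (fun ψ g => g.apply O ψ) (Pi.single (fun _ => false) 1)

/-- The probability that measuring all qubits at the end gives `s`, when the oracle is `O ω` for
`ω` uniform in `Ω`. -/
noncomputable def outputProb {Ω : Type} [Fintype Ω] {a b w : ℕ} (O : Ω → Bits a → Bits b)
    (circ : List (QGate a b w)) (s : Wire a b w → Bool) : ℝ :=
  (∑ ω, Complex.normSq (finalState circ (O ω) s)) / (Fintype.card Ω : ℝ)

/-- A polynomial-time quantum algorithm with oracle access: a sequence of circuits with
polynomially many qubits and gates. -/
structure QAlgorithm (a b : ℕ → ℕ) where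
  work : ℕ → ℕ
  circ : ∀ n, List (QGate (a n) (b n) (work n))
  poly : ∃ p : Polynomial ℕ, ∀ n,
    a n + b n + work n ≤ p.eval n ∧ (circ n).length ≤ p.eval n

/-- Two families of random functions, used as quantum oracles, are computationally
indistinguishable: for every polynomial-time quantum algorithm the variational distance of its
output distributions is negligible. -/
def QIndistinguishable {Ω Ω' : ℕ → Type} [∀ n, Fintype (Ω n)] [∀ n, Fintype (Ω' n)]
    {a b : ℕ → ℕ} (O : ∀ n, Ω n → Bits (a n) → Bits (b n))
    (O' : ∀ n, Ω' n → Bits (a n) → Bits (b n)) : Prop :=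
  ∀ D : QAlgorithm a b, Negligible fun n =>
    ∑ s, |outputProb (O n) (D.circ n) s - outputProb (O' n) (D.circ n) s|

/-! ### Signature schemes, adversaries and problems -/

/-- A signature scheme in the random oracle model.  The random oracle is a uniformly random function
`{0,1}^hIn → hRan` with `hRan ⊆ {0,1}^hOut`.  Signing is derandomized: the coins used for a message
are a fixed private random function of the message. -/
structure SigScheme where
  skLen : ℕ → ℕ
  pkLen : ℕ → ℕ
  msgLen : ℕ → ℕ
  sigLen : ℕ → ℕ
  hIn : ℕ → ℕ
  hOut : ℕ → ℕ
  hRan : ∀ n, Finset (Bits (hOut n))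
  genCoins : ℕ → ℕ
  signCoins : ℕ → ℕ
  /-- key generation, returning `(sk, pk)` -/
  gen : ∀ n, Bits (genCoins n) → Bits (skLen n) × Bits (pkLen n)
  /-- the signature of a message under a secret key, with given coins -/
  sign : ∀ n, (Bits (hIn n) → Bits (hOut n)) → Bits (skLen n) → Bits (msgLen n) →
    Bits (signCoins n) → Bits (sigLen n)
  /-- validity of a signature of a message under a public key -/
  verify : ∀ n, (Bits (hIn n) → Bits (hOut n)) → Bits (pkLen n) → Bits (msgLen n) →
    Bits (sigLen n) → Prop
  correct : ∀ n (O : Bits (hIn n) → Bits (hOut n)), (∀ r, O r ∈ hRan n) →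
    ∀ c m ρ, verify n O (gen n c).2 m (sign n O (gen n c).1 m ρ)

/-- The program `prog` on input `1ⁿ`, `pk` and coins `r`, with access to a hash oracle `O` (number
`0`) and to a signing oracle `T` (number `1`), halts with output `(m, σ)` in the registers `0, 1`
after `t` steps; `tr` lists its queries, all of them well-formed. -/
def SigScheme.Attack (S : SigScheme) (prog : Cmd) (n : ℕ)
    (O : Bits (S.hIn n) → Bits (S.hOut n)) (T : Bits (S.msgLen n) → Bits (S.sigLen n))
    (pk : Bits (S.pkLen n)) (r m σ : Str) (t : ℕ) (tr : List (ℕ × Str)) : Prop :=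
  (∃ s : Store, Eval (twoOracles O T) prog
      (inputStore [List.replicate n true, List.ofFn pk, r]) s t tr ∧ s 0 = m ∧ s 1 = σ) ∧
    ∀ q ∈ tr, (∃ x : Bits (S.hIn n), q = (0, List.ofFn x)) ∨
      ∃ x : Bits (S.msgLen n), q = (1, List.ofFn x)

/-- A classical probabilistic polynomial-time adversary against a signature scheme. -/
structure Adversary (S : SigScheme) where
  prog : Cmd
  /-- bound on the running time, and the number of coins supplied -/
  time : Polynomial ℕ
  runs : ∀ n (O : Bits (S.hIn n) → Bits (S.hOut n)) (T : Bits (S.msgLen n) → Bits (S.sigLen n))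
    (pk : Bits (S.pkLen n)) (r : Bits (time.eval n)),
    ∃ (m : Bits (S.msgLen n)) (σ : Bits (S.sigLen n)) (t : ℕ) (tr : List (ℕ × Str)),
      S.Attack prog n O T pk (List.ofFn r) (List.ofFn m) (List.ofFn σ) t tr ∧ t ≤ time.eval n

namespace Adversary

variable {S : SigScheme} (A : Adversary S) (n : ℕ) (O : Bits (S.hIn n) → Bits (S.hOut n))
  (T : Bits (S.msgLen n) → Bits (S.sigLen n)) (pk : Bits (S.pkLen n)) (r : Bits (A.time.eval n))

/-- The message of the forgery candidate. -/
noncomputable def msg : Bits (S.msgLen n) := (A.runs n O T pk r).choose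

/-- The signature of the forgery candidate. -/
noncomputable def sig : Bits (S.sigLen n) := (A.runs n O T pk r).choose_spec.choose

/-- The oracle queries made. -/
noncomputable def trace : List (ℕ × Str) :=
  (A.runs n O T pk r).choose_spec.choose_spec.choose_spec.choose

/-- The adversary asked for a signature of `m`. -/
def Asked (m : Bits (S.msgLen n)) : Prop := (1, List.ofFn m) ∈ A.trace n O T pk r

/-- The adversary outputs a valid signature, relative to `pk` and `O`, of a message for which it
never asked for a signature. -/
def Forges : Prop :=
  ¬ A.Asked n O T pk r (A.msg n O T pk r) ∧
    S.verify n O pk (A.msg n O T pk r) (A.sig n O T pk r)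

/-- The advantage in the chosen message attack game: key pair, random oracle, private signing
randomness and coins of the adversary are random. -/
noncomputable def advantage : ℝ :=
  prob fun ω : Bits (S.genCoins n) × (Bits (S.hIn n) → ↥(S.hRan n)) ×
      (Bits (S.msgLen n) → Bits (S.signCoins n)) × Bits (A.time.eval n) =>
    A.Forges n (fun x => (ω.2.1 x : Bits (S.hOut n)))
      (fun m => S.sign n (fun x => (ω.2.1 x : Bits (S.hOut n))) (S.gen n ω.1).1 m (ω.2.2.1 m))
      (S.gen n ω.1).2 ω.2.2.2

end Adversary

/-- A problem `(Game, 0)` whose challenger sends an instance, answers no queries, and accepts or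
rejects the answer. -/
structure Problem where
  instLen : ℕ → ℕ
  ansLen : ℕ → ℕ
  coins : ℕ → ℕ
  /-- the instance chosen by the challenger, as a function of its coins -/
  inst : ∀ n, Bits (coins n) → Bits (instLen n)
  /-- the challenger outputs `1` -/
  wins : ∀ n, Bits (instLen n) → Bits (ansLen n) → Prop

/-! ### History-free reductions -/

/-- The algorithms START, RAND, SIGN, FINISH and INSTANCE of a reduction from a problem `P` to the
security of `S`.  RAND, SIGN and FINISH share a random oracle `{0,1}^cIn → {0,1}^cOut`, which is
the source of all their randomness, and see the current query and the private state only; SIGN may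
abort (`none`). -/
structure Reduction (S : SigScheme) (P : Problem) where
  stLen : ℕ → ℕ
  cIn : ℕ → ℕ
  cOut : ℕ → ℕ
  start : ∀ n, Bits (P.instLen n) → Bits (S.pkLen n) × Bits (stLen n)
  rand : ∀ n, (Bits (cIn n) → Bits (cOut n)) → Bits (S.hIn n) → Bits (stLen n) → Bits (S.hOut n)
  sign : ∀ n, (Bits (cIn n) → Bits (cOut n)) → Bits (S.msgLen n) → Bits (stLen n) →
    Option (Bits (S.sigLen n))
  finish : ∀ n, (Bits (cIn n) → Bits (cOut n)) → Bits (S.msgLen n) → Bits (S.sigLen n) →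
    Bits (stLen n) → Bits (P.ansLen n)
  instOf : ∀ n, Bits (S.pkLen n) → Bits (P.instLen n)

namespace Reduction

variable {S : SigScheme} {P : Problem} (R : Reduction S P)

/-- The classical random oracle shared by RAND, SIGN and FINISH. -/
abbrev COracle (n : ℕ) : Type := Bits (R.cIn n) → Bits (R.cOut n)

/-- The five algorithms run in polynomial time (relative to the shared oracle). -/
structure Efficient : Prop where
  start_pk : PolyTime (ι := fun n => Bits (P.instLen n))
    (fun _ x => [List.ofFn x]) (fun n x => List.ofFn (R.start n x).1)
  start_st : PolyTime (ι := fun n => Bits (P.instLen n))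
    (fun _ x => [List.ofFn x]) (fun n x => List.ofFn (R.start n x).2)
  rand : OraclePolyTime (ι := fun n => R.COracle n × Bits (S.hIn n) × Bits (R.stLen n))
    (fun _ i => oneOracle i.1) (fun _ i => [List.ofFn i.2.1, List.ofFn i.2.2])
    (fun n i => List.ofFn (R.rand n i.1 i.2.1 i.2.2))
  sign : OraclePolyTime (ι := fun n => R.COracle n × Bits (S.msgLen n) × Bits (R.stLen n))
    (fun _ i => oneOracle i.1) (fun _ i => [List.ofFn i.2.1, List.ofFn i.2.2])
    (fun n i => encOption (R.sign n i.1 i.2.1 i.2.2))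
  finish : OraclePolyTime
    (ι := fun n => R.COracle n × Bits (S.msgLen n) × Bits (S.sigLen n) × Bits (R.stLen n))
    (fun _ i => oneOracle i.1)
    (fun _ i => [List.ofFn i.2.1, List.ofFn i.2.2.1, List.ofFn i.2.2.2])
    (fun n i => List.ofFn (R.finish n i.1 i.2.1 i.2.2.1 i.2.2.2))
  instOf : PolyTime (ι := fun n => Bits (S.pkLen n))
    (fun _ pk => [List.ofFn pk]) (fun n pk => List.ofFn (R.instOf n pk))

section Simulation

variable (A : Adversary S) (n : ℕ) (x : Bits (P.instLen n)) (Oc : R.COracle n)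

/-- The public key computed by START. -/
def simPk : Bits (S.pkLen n) := (R.start n x).1

/-- The private state computed by START. -/
def simSt : Bits (R.stLen n) := (R.start n x).2

/-- The simulated random oracle `r ↦ RAND(r, z)`. -/
def simHash : Bits (S.hIn n) → Bits (S.hOut n) := fun y => R.rand n Oc y (R.simSt n x)

/-- The simulated signing oracle; after an abort the reduction has failed and its further answers
are irrelevant. -/
def simSign : Bits (S.msgLen n) → Bits (S.sigLen n) :=
  fun m => (R.sign n Oc m (R.simSt n x)).getD fun _ => false

/-- No signature query of the adversary makes SIGN abort. -/
def NoAbort (r : Bits (A.time.eval n)) : Prop :=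
  ∀ m, A.Asked n (R.simHash n x Oc) (R.simSign n x Oc) (R.simPk n x) r m →
    R.sign n Oc m (R.simSt n x) ≠ none

open scoped Classical in
/-- The output of the algorithm `B` built from the adversary `A`, on instance `x`, with shared
oracle `Oc` and coins `r` for `A`: run START, run `A` on the public key with the simulated oracles,
abort if SIGN aborts, and apply FINISH to the output of `A`. -/
noncomputable def solver (r : Bits (A.time.eval n)) : Option (Bits (P.ansLen n)) :=
  if R.NoAbort A n x Oc r then
    some (R.finish n Oc (A.msg n (R.simHash n x Oc) (R.simSign n x Oc) (R.simPk n x) r)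
      (A.sig n (R.simHash n x Oc) (R.simSign n x Oc) (R.simPk n x) r) (R.simSt n x))
  else none

/-- `B` makes the challenger output `1`. -/
def Solves (r : Bits (A.time.eval n)) : Prop :=
  ∃ y, R.solver A n x Oc r = some y ∧ P.wins n x y

/-- `B` does not abort and `A`, run by `B`, outputs a valid forgery relative to the simulated
public key and random oracle. -/
def SimForges (r : Bits (A.time.eval n)) : Prop :=
  R.NoAbort A n x Oc r ∧ A.Forges n (R.simHash n x Oc) (R.simSign n x Oc) (R.simPk n x) r

end Simulation

/-- Probability of an event in the game for `P` played by `B` (built from `A`): the instance chosen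
by the challenger, the shared oracle and the coins of `A` are random. -/
noncomputable def simProb (A : Adversary S) (n : ℕ)
    (E : Bits (P.instLen n) → R.COracle n → Bits (A.time.eval n) → Prop) : ℝ :=
  prob fun ω : Bits (P.coins n) × R.COracle n × Bits (A.time.eval n) =>
    E (P.inst n ω.1) ω.2.1 ω.2.2

/-- The reduction is history-free. -/
structure IsHistoryFree : Prop where
  /-- START, RAND, SIGN, FINISH and INSTANCE are efficient. -/
  efficient : R.Efficient
  /-- From a classical PPT adversary one obtains a classical PPT algorithm `B` for `P`. -/
  solver_efficient : ∀ A : Adversary S, OraclePolyTime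
    (ι := fun n => R.COracle n × Bits (P.instLen n) × Bits (A.time.eval n))
    (fun _ i => oneOracle i.1) (fun _ i => [List.ofFn i.2.1, List.ofFn i.2.2])
    (fun n i => encOption (R.solver A n i.2.1 i.1 i.2.2))
  /-- If the adversary breaks the scheme, then `B` solves the problem. -/
  security : ∀ A : Adversary S, ¬ Negligible (fun n => A.advantage n) →
    ¬ Negligible fun n => R.simProb A n fun x Oc r => R.Solves A n x Oc r
  /-- `START(INSTANCE(pk)) = (pk, z)` for some `z`. -/
  start_instOf : ∀ n pk, ∃ z, R.start n (R.instOf n pk) = (pk, z)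
  /-- `INSTANCE(pk)`, for a random public key, is distributed almost as the instances of `P`. -/
  instOf_close : Negligible fun n => ∑ x : Bits (P.instLen n),
    |prob (fun c => R.instOf n (S.gen n c).2 = x) - prob (fun i => P.inst n i = x)|
  /-- For fixed `z`, the quantum oracle `|x, y⟩ ↦ |x, y ⊕ RAND(x, z)⟩` is indistinguishable from a
  random oracle. -/
  rand_indist : ∀ i : ∀ n, Bits (P.coins n),
    QIndistinguishable (a := S.hIn) (b := S.hOut) (Ω := fun n => R.COracle n)
      (Ω' := fun n => Bits (S.hIn n) → ↥(S.hRan n))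
      (fun n Oc => R.simHash n (P.inst n (i n)) Oc) (fun _ H y => (H y : Bits _))
  /-- If SIGN does not abort, it gives a valid signature relative to the oracle RAND. -/
  sign_valid : ∀ n c Oc m σ,
    R.sign n Oc m (R.simSt n (R.instOf n (S.gen n c).2)) = some σ →
      S.verify n (R.simHash n (R.instOf n (S.gen n c).2) Oc) (S.gen n c).2 m σ
  /-- Given that SIGN does not abort on the messages of a set `M`, its signatures of these messages
  are, jointly with the oracle RAND, distributed negligibly close to those of the correct signing
  algorithm relative to that oracle; the distance grows at most linearly with `M`. -/
  sign_close : ∃ ε : ℕ → ℝ, Negligible ε ∧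
    ∀ n (c : Bits (S.genCoins n)) (M : Finset (Bits (S.msgLen n))),
      ∑ H : Bits (S.hIn n) → Bits (S.hOut n), ∑ τ : ↥M → Bits (S.sigLen n),
        |prob (fun Oc : R.COracle n =>
            R.simHash n (R.instOf n (S.gen n c).2) Oc = H ∧
            ∀ m : ↥M, R.sign n Oc m (R.simSt n (R.instOf n (S.gen n c).2)) = some (τ m)) -
          prob (fun ω : R.COracle n × (Bits (S.msgLen n) → Bits (S.signCoins n)) =>
            R.simHash n (R.instOf n (S.gen n c).2) ω.1 = H ∧
            (∀ m : ↥M, R.sign n ω.1 m (R.simSt n (R.instOf n (S.gen n c).2)) ≠ none) ∧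
            ∀ m : ↥M, S.sign n H (S.gen n c).1 m (ω.2 m) = τ m)|
        ≤ M.card * ε n * prob (fun Oc : R.COracle n =>
            ∀ m : ↥M, R.sign n Oc m (R.simSt n (R.instOf n (S.gen n c).2)) ≠ none)
  /-- With non-negligible probability, no signature query aborts. -/
  no_abort : ∀ A : Adversary S,
    ¬ Negligible fun n => R.simProb A n fun x Oc r => R.NoAbort A n x Oc r
  /-- A valid forgery makes the challenger accept with non-negligible probability. -/
  finish_solves : ∀ A : Adversary S, ∃ δ : ℕ → ℝ, ¬ Negligible δ ∧ ∀ n, 0 ≤ δ n ∧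
    δ n * R.simProb A n (fun x Oc r => R.SimForges A n x Oc r) ≤
      R.simProb A n fun x Oc r => R.SimForges A n x Oc r ∧ R.Solves A n x Oc r

end Reduction

/-! ### Preimage sampleable trapdoor functions, FDH-PSF and the reduction -/

/-- A preimage sampleable trapdoor function: PPT algorithms for key generation, domain sampling,
evaluation `f(pk, ·) : dom → ran`, and preimage sampling; `(gen n c).1` is the secret key and
`(gen n c).2` the public key. -/
structure PSF where
  skLen : ℕ → ℕ
  pkLen : ℕ → ℕ
  domLen : ℕ → ℕ
  ranLen : ℕ → ℕ
  genCoins : Polynomial ℕ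
  sampleCoins : Polynomial ℕ
  invCoins : Polynomial ℕ
  dom : ∀ n, Finset (Bits (domLen n))
  ran : ∀ n, Finset (Bits (ranLen n))
  gen : ∀ n, Bits (genCoins.eval n) → Bits (skLen n) × Bits (pkLen n)
  sample : ∀ n, Bits (sampleCoins.eval n) → Bits (domLen n)
  f : ∀ n, Bits (pkLen n) → Bits (domLen n) → Bits (ranLen n)
  inv : ∀ n, Bits (skLen n) → Bits (ranLen n) → Bits (invCoins.eval n) → Bits (domLen n)
  gen_sk_ppt : PolyTime (ι := fun n => Bits (genCoins.eval n))
    (fun _ c => [List.ofFn c]) (fun n c => List.ofFn (gen n c).1)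
  gen_pk_ppt : PolyTime (ι := fun n => Bits (genCoins.eval n))
    (fun _ c => [List.ofFn c]) (fun n c => List.ofFn (gen n c).2)
  sample_ppt : PolyTime (ι := fun n => Bits (sampleCoins.eval n))
    (fun _ r => [List.ofFn r]) (fun n r => List.ofFn (sample n r))
  f_ppt : PolyTime (ι := fun n => Bits (pkLen n) × Bits (domLen n))
    (fun _ i => [List.ofFn i.1, List.ofFn i.2]) (fun n i => List.ofFn (f n i.1 i.2))
  inv_ppt : PolyTime (ι := fun n => Bits (skLen n) × Bits (ranLen n) × Bits (invCoins.eval n))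
    (fun _ i => [List.ofFn i.1, List.ofFn i.2.1, List.ofFn i.2.2])
    (fun n i => List.ofFn (inv n i.1 i.2.1 i.2.2))
  sample_mem : ∀ n r, sample n r ∈ dom n
  f_mem : ∀ n c, ∀ x ∈ dom n, f n (gen n c).2 x ∈ ran n
  /-- `f(pk, Sample)` is negligibly close to uniform on the range. -/
  sample_uniform : ∃ ε : ℕ → ℝ, Negligible ε ∧ ∀ n c,
    ∑ y ∈ ran n, |prob (fun r => f n (gen n c).2 (sample n r) = y) - 1 / ((ran n).card : ℝ)| ≤ ε n
  /-- Preimage sampling yields preimages. -/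
  inv_mem : ∀ n c, ∀ y ∈ ran n, ∀ ρ,
    inv n (gen n c).1 y ρ ∈ dom n ∧ f n (gen n c).2 (inv n (gen n c).1 y ρ) = y
  /-- Preimage sampling is negligibly close to `Sample` conditioned on `f(pk, Sample) = y`. -/
  inv_close : ∃ ε : ℕ → ℝ, Negligible ε ∧ ∀ n c, ∀ y ∈ ran n,
    prob (fun r => f n (gen n c).2 (sample n r) = y) ≠ 0 →
    ∑ x ∈ dom n, |prob (fun ρ => inv n (gen n c).1 y ρ = x) -
      prob (fun r => sample n r = x ∧ f n (gen n c).2 (sample n r) = y) /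
        prob (fun r => f n (gen n c).2 (sample n r) = y)| ≤ ε n
  /-- Preimage min-entropy: given `f(pk, Sample) = y`, each element has negligible probability. -/
  min_entropy : ∃ ε : ℕ → ℝ, Negligible ε ∧ ∀ n c, ∀ y ∈ ran n,
    prob (fun r => f n (gen n c).2 (sample n r) = y) ≠ 0 →
    ∀ x, prob (fun r => sample n r = x ∧ f n (gen n c).2 (sample n r) = y) /
        prob (fun r => f n (gen n c).2 (sample n r) = y) ≤ ε n

/-- Full Domain Hash instantiated with the PSF `F`, for messages of length `ℓ(n)`:
a signature of `m` is `F.inv sk (O m)`, and `σ` is valid if it lies in the domain and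
`F.f pk σ = O m`. -/
def fdhPSF (F : PSF) (ℓ : Polynomial ℕ) : SigScheme where
  skLen := F.skLen
  pkLen := F.pkLen
  msgLen n := ℓ.eval n
  sigLen := F.domLen
  hIn n := ℓ.eval n
  hOut := F.ranLen
  hRan := F.ran
  genCoins n := F.genCoins.eval n
  signCoins n := F.invCoins.eval n
  gen := F.gen
  sign n O sk m ρ := F.inv n sk (O m) ρ
  verify n O pk m σ := σ ∈ F.dom n ∧ F.f n pk σ = O m
  correct n O hO c m ρ := F.inv_mem n c (O m) (hO m) ρ

/-- The collision problem for the PSF `F`: given a random public key, find distinct `x₁, x₂` in the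
domain with `f(pk, x₁) = f(pk, x₂)`.  The answer is the concatenation of `x₁` and `x₂`. -/
def collisionProblem (F : PSF) : Problem where
  instLen := F.pkLen
  ansLen n := F.domLen n + F.domLen n
  coins n := F.genCoins.eval n
  inst n c := (F.gen n c).2
  wins n pk y :=
    let x₁ : Bits (F.domLen n) := fun i => y (Fin.castAdd (F.domLen n) i)
    let x₂ : Bits (F.domLen n) := fun i => y (Fin.natAdd (F.domLen n) i)
    x₁ ∈ F.dom n ∧ x₂ ∈ F.dom n ∧ x₁ ≠ x₂ ∧ F.f n pk x₁ = F.f n pk x₂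

/-- The reduction from collision finding for `F` to forging FDH-PSF signatures. -/
def psfReduction (F : PSF) (ℓ : Polynomial ℕ) :
    Reduction (fdhPSF F ℓ) (collisionProblem F) where
  stLen := F.pkLen
  cIn n := ℓ.eval n
  cOut n := F.sampleCoins.eval n
  start _ pk := (pk, pk)
  rand n Oc r pk := F.f n pk (F.sample n (Oc r))
  sign n Oc m _ := some (F.sample n (Oc m))
  finish n Oc m σ _ := Fin.append (F.sample n (Oc m)) σ
  instOf _ pk := pk

/-!
The reduction of collision finding to forging FDH-PSF signatures is history-free.

SIGN never aborts, and RAND answers `m` with `f(pk, ·)` of what SIGN answers, so that both simulated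
oracles are determined by one random function `T` with independent values distributed as `Sample`.
Everything about the reduction is a statement about such functions.

*Efficiency.*  The programs for RAND, SIGN and FINISH call the programs of the PSF; keys, preimages
and hash values have polynomial length because registers grow by at most one bit per step.  The
solver runs the adversary's program with each oracle query replaced by a call
(`Cmd.simulate`, `Eval.simulate`).

*Security.*  In the real game a signature determines the hash value as well.  Real and simulated
game therefore differ only in the distribution of the independent values of `T`, whose variational
distance is at most the sum of the errors of `sample_uniform` and `inv_close`
(`PSF.sum_inv_uniform_close`).  Runs of a program with two oracles agree until a common query is
answered differently (`Eval.eq_or_diverge`).  Hence, by induction on the number of queries, each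
query adds at most that distance (`abs_prob_sub_prob_le_of_adaptive`).  A forgery `σ` of `m` gives a
collision unless `σ = T m`.  The adversary has learnt at most `f(pk, T m)`; resampling `T m`
among the preimages of this value shows that `σ = T m` holds for at most a fraction of the
forgeries that is bounded by the preimage min-entropy (`prob_guess_le`).

*Quantum indistinguishability.*  Two distributions at variational distance `2ε` contain a common
distribution `κ` with weight `1 - ε` (`exists_common_part`).  A random function with values from
either of them is a random function `K` with values from `κ`, overwritten at a random set of points
of density `ε` that is independent of `K`.  The state of the algorithm that runs with `K` is
independent of that set, so that a query puts weight `ε` on it on average, and overwriting changes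
the state by at most `2 √ε` per query on average (`iidAvg_qNorm_sub_le`).

*Signatures.*  For one message, the pair of hash value and signature changes by the error of
`inv_close`; messages are independent, and distances of product distributions add up
(`sum_abs_prod_sub_prod_le`).
-/

/-! ### Negligible functions -/

namespace Negligible

theorem of_abs_le {f g : ℕ → ℝ} (hf : Negligible f) (h : ∀ n, |g n| ≤ |f n|) : Negligible g :=
  Asymptotics.SuperpolynomialDecay.trans_abs_le hf h

theorem of_nonneg_of_le {f g : ℕ → ℝ} (hf : Negligible f) (h₀ : ∀ n, 0 ≤ g n)
    (h : ∀ n, g n ≤ f n) : Negligible g :=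
  hf.of_abs_le fun n => abs_le_abs_of_nonneg (h₀ n) (h n)

protected theorem abs {f : ℕ → ℝ} (hf : Negligible f) : Negligible fun n => |f n| :=
  hf.of_abs_le fun n => by simp

protected theorem zero : Negligible fun _ => 0 :=
  Asymptotics.superpolynomialDecay_zero _ _

protected theorem add {f g : ℕ → ℝ} (hf : Negligible f) (hg : Negligible g) :
    Negligible fun n => f n + g n :=
  Asymptotics.SuperpolynomialDecay.add hf hg

theorem polynomial_mul {f : ℕ → ℝ} (hf : Negligible f) (p : Polynomial ℕ) :
    Negligible fun n => ((p.eval n : ℕ) : ℝ) * f n := by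
  have h := Asymptotics.SuperpolynomialDecay.polynomial_mul hf (p.map (Nat.castRingHom ℝ))
  refine h.congr fun n => ?_
  have h' : (p.map (Nat.castRingHom ℝ)).eval (n : ℝ) = ((p.eval n : ℕ) : ℝ) := by
    simp
  rw [h']

protected theorem sqrt {f : ℕ → ℝ} (hf : Negligible f) : Negligible fun n => √(f n) := by
  intro k
  have h := (Real.continuous_sqrt.tendsto 0).comp (hf (2 * k))
  rw [Real.sqrt_zero] at h
  refine h.congr fun n => ?_
  have h' : ((n : ℝ) ^ (2 * k)) = ((n : ℝ) ^ k) ^ 2 := by rw [mul_comm, pow_mul]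
  simp only [Function.comp_apply, h']
  rw [Real.sqrt_mul (sq_nonneg _), Real.sqrt_sq (by positivity)]

theorem tendsto_zero {f : ℕ → ℝ} (hf : Negligible f) :
    Filter.Tendsto f Filter.atTop (nhds 0) := by
  simpa using hf 0

theorem not_of_tendsto_one {f : ℕ → ℝ} (hf : Filter.Tendsto f Filter.atTop (nhds 1)) :
    ¬ Negligible f := fun h =>
  zero_ne_one (tendsto_nhds_unique h.tendsto_zero hf)

end Negligible

/-! ### Averages and probabilities over finite sets -/

/-- The expectation of `F` under the uniform distribution. -/
noncomputable def avg {Ω : Type} [Fintype Ω] (F : Ω → ℝ) : ℝ := (∑ ω, F ω) / Fintype.card Ω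

section Avg

variable {Ω Ω' ι : Type} [Fintype Ω] [Fintype Ω']

open scoped Classical in
theorem prob_eq_avg (E : Ω → Prop) : prob E = avg fun ω => if E ω then 1 else 0 := by
  simp [prob, avg]

theorem avg_mono {F G : Ω → ℝ} (h : ∀ ω, F ω ≤ G ω) : avg F ≤ avg G := by
  unfold avg
  gcongr with ω
  exact h ω

theorem avg_const [Nonempty Ω] (c : ℝ) : avg (fun _ : Ω => c) = c := by
  simp [avg]

theorem avg_add (F G : Ω → ℝ) : avg (fun ω => F ω + G ω) = avg F + avg G := by
  simp [avg, Finset.sum_add_distrib, add_div]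

theorem avg_sub (F G : Ω → ℝ) : avg (fun ω => F ω - G ω) = avg F - avg G := by
  simp [avg, Finset.sum_sub_distrib, sub_div]

theorem avg_mul_left (c : ℝ) (F : Ω → ℝ) : avg (fun ω => c * F ω) = c * avg F := by
  simp [avg, ← Finset.mul_sum, mul_div_assoc]

theorem avg_sum (s : Finset ι) (F : ι → Ω → ℝ) :
    avg (fun ω => ∑ i ∈ s, F i ω) = ∑ i ∈ s, avg (F i) := by
  unfold avg
  rw [Finset.sum_comm, Finset.sum_div]

theorem avg_prod (F : Ω × Ω' → ℝ) : avg F = avg fun a => avg fun b => F (a, b) := by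
  simp only [avg, Fintype.sum_prod_type, Fintype.card_prod, Nat.cast_mul, ← Finset.sum_div,
    div_div]
  rw [mul_comm]

theorem avg_comm (F : Ω → Ω' → ℝ) : (avg fun a => avg fun b => F a b) =
    avg fun b => avg fun a => F a b := by
  simp only [avg, ← Finset.sum_div, div_div]
  rw [Finset.sum_comm, mul_comm]

theorem avg_equiv (e : Ω ≃ Ω') (F : Ω' → ℝ) : (avg fun ω => F (e ω)) = avg F := by
  simp only [avg, Fintype.card_congr e, e.sum_comp]

theorem prob_nonneg (E : Ω → Prop) : 0 ≤ prob E := by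
  unfold prob; positivity

theorem prob_mono {E E' : Ω → Prop} (h : ∀ ω, E ω → E' ω) : prob E ≤ prob E' := by
  classical
  simp only [prob_eq_avg]
  refine avg_mono fun ω => ?_
  by_cases h1 : E ω
  · simp [h1, h ω h1]
  · by_cases h2 : E' ω <;> simp [h1, h2]

theorem prob_congr {E E' : Ω → Prop} (h : ∀ ω, E ω ↔ E' ω) : prob E = prob E' := by
  rw [funext fun ω => propext (h ω)]

theorem prob_true [Nonempty Ω] : prob (fun _ : Ω => True) = 1 := by
  simp [prob_eq_avg, avg_const]

theorem prob_false : prob (fun _ : Ω => False) = 0 := by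
  simp [prob]

theorem prob_eq_one [Nonempty Ω] {E : Ω → Prop} (h : ∀ ω, E ω) : prob E = 1 := by
  rw [← prob_true (Ω := Ω)]
  exact prob_congr fun ω => by simp [h ω]

open scoped Classical in
theorem prob_eq_self (a : Ω) : prob (fun ω => ω = a) = 1 / Fintype.card Ω := by
  have h : Finset.univ.filter (fun ω => ω = a) = {a} := by
    ext
    simp
  rw [prob, h, Finset.card_singleton, Nat.cast_one]

theorem prob_le_one (E : Ω → Prop) : prob E ≤ 1 := by
  unfold prob
  exact div_le_one_of_le₀ (by exact_mod_cast Finset.card_le_univ _) (Nat.cast_nonneg _)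

theorem prob_prod (E : Ω × Ω' → Prop) : prob E = avg fun a => prob fun b => E (a, b) := by
  classical
  simp only [prob_eq_avg, avg_prod]

theorem prob_equiv (e : Ω ≃ Ω') (E : Ω' → Prop) : (prob fun ω => E (e ω)) = prob E := by
  classical
  simp only [prob_eq_avg]
  exact avg_equiv e fun ω => if E ω then 1 else 0

/-- The law of total expectation, for the values of a random variable `φ`. -/
theorem avg_comp_eq_sum [Fintype ι] (φ : Ω → ι) (F : ι → ℝ) :
    (avg fun ω => F (φ ω)) = ∑ b, prob (fun ω => φ ω = b) * F b := by
  classical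
  simp only [prob_eq_avg, avg, div_mul_eq_mul_div, ← Finset.sum_div]
  congr 1
  simp only [Finset.sum_mul]
  rw [Finset.sum_comm]
  simp

theorem sum_prob_eq_and [Fintype ι] (φ : Ω → ι) (E : Ω → Prop) :
    ∑ b, prob (fun ω => φ ω = b ∧ E ω) = prob E := by
  classical
  simp only [prob_eq_avg, ← avg_sum]
  congr 1
  funext ω
  by_cases h : E ω <;> simp [h]

theorem sum_prob_eq [Nonempty Ω] [Fintype ι] (φ : Ω → ι) :
    ∑ b, prob (fun ω => φ ω = b) = 1 := by
  have h := sum_prob_eq_and φ fun _ => True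
  simpa [prob_true] using h

end Avg

section Update

variable {α β γ : Type} [Fintype α] [DecidableEq α] [Fintype β] [Fintype γ]

/-- Resampling a coordinate: `(a, h) ↦ (h x, h with x ↦ a)` is an involution. -/
theorem sum_sum_update {M : Type} [AddCommMonoid M] (x : α) (G : β → (α → β) → M) :
    ∑ a, ∑ h : α → β, G (h x) (Function.update h x a) = ∑ a, ∑ h : α → β, G a h := by
  rw [← Fintype.sum_prod_type', ← Fintype.sum_prod_type']
  have hi : Function.Involutive
      fun p : β × (α → β) => (p.2 x, Function.update p.2 x p.1) := by
    rintro ⟨a, h⟩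
    simp
  exact Equiv.sum_comp hi.toPerm fun p : β × (α → β) => G p.1 p.2

theorem avg_update [Nonempty β] (x : α) (G : (α → β) → ℝ) :
    avg G = avg fun a : β => avg fun h => G (Function.update h x a) := by
  have h := sum_sum_update x fun _ : β => G
  simp only [avg, ← Finset.sum_div, h, Finset.sum_const, Finset.card_univ, nsmul_eq_mul]
  field_simp

/-- Independence of the coordinates of a uniformly random function. -/
theorem prob_forall (P : α → β → Prop) :
    prob (fun h : α → β => ∀ m, P m (h m)) = ∏ m, prob (P m) := by
  classical
  unfold prob
  rw [Finset.prod_div_distrib, ← Nat.cast_prod, ← Nat.cast_prod, ← Fintype.card_piFinset]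
  congr 3
  · ext h
    simp [Fintype.mem_piFinset]
  · simp

end Update

/-! ### Runs of programs -/

/-- Two lists of queries share an initial segment, at the end of which is a query that the oracles
`O` and `O'` answer differently. -/
def Diverge (O O' : ℕ → Str → Str) (tr tr' : List (ℕ × Str)) : Prop :=
  ∃ pre q r r', tr = pre ++ q :: r ∧ tr' = pre ++ q :: r' ∧ O q.1 q.2 ≠ O' q.1 q.2

theorem Diverge.append {O O' : ℕ → Str → Str} {tr tr' : List (ℕ × Str)} (h : Diverge O O' tr tr')
    (a a' : List (ℕ × Str)) : Diverge O O' (tr ++ a) (tr' ++ a') := by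
  obtain ⟨pre, q, r, r', rfl, rfl, hq⟩ := h
  exact ⟨pre, q, r ++ a, r' ++ a', by simp, by simp, hq⟩

theorem Diverge.append_left {O O' : ℕ → Str → Str} {tr tr' : List (ℕ × Str)}
    (h : Diverge O O' tr tr') (a : List (ℕ × Str)) : Diverge O O' (a ++ tr) (a ++ tr') := by
  obtain ⟨pre, q, r, r', rfl, rfl, hq⟩ := h
  exact ⟨a ++ pre, q, r, r', by simp, by simp, hq⟩

namespace Eval

variable {O O' : ℕ → Str → Str} {c : Cmd} {s s₁ s₂ : Store} {t₁ t₂ : ℕ} {tr₁ tr₂ : List (ℕ × Str)}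

/-- A program is deterministic and adaptive: runs with different oracles agree until the oracles
give different answers to the same query. -/
theorem eq_or_diverge (h₁ : Eval O c s s₁ t₁ tr₁) (h₂ : Eval O' c s s₂ t₂ tr₂) :
    (s₁ = s₂ ∧ t₁ = t₂ ∧ tr₁ = tr₂) ∨ Diverge O O' tr₁ tr₂ := by
  induction h₁ generalizing s₂ t₂ tr₂ with
  | skip s => cases h₂; exact .inl ⟨rfl, rfl, rfl⟩
  | push b x s => cases h₂; exact .inl ⟨rfl, rfl, rfl⟩
  | pop x s => cases h₂; exact .inl ⟨rfl, rfl, rfl⟩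
  | copy x y s => cases h₂; exact .inl ⟨rfl, rfl, rfl⟩
  | query k x y s =>
    cases h₂
    by_cases h : O k (s x) = O' k (s x)
    · rw [h]; exact .inl ⟨rfl, rfl, rfl⟩
    · exact .inr ⟨[], (k, s x), [], [], rfl, rfl, h⟩
  | seq _ _ ih₁ ih₂ =>
    cases h₂ with
    | seq g₁ g₂ =>
      rcases ih₁ g₁ with ⟨rfl, rfl, rfl⟩ | hd
      · rcases ih₂ g₂ with ⟨rfl, rfl, rfl⟩ | hd
        · exact .inl ⟨rfl, rfl, rfl⟩
        · exact .inr (hd.append_left _)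
      · exact .inr (hd.append _ _)
  | branch_nil hx _ ih =>
    cases h₂ with
    | branch_nil _ g =>
      rcases ih g with ⟨rfl, rfl, rfl⟩ | hd
      · exact .inl ⟨rfl, rfl, rfl⟩
      · exact .inr hd
    | branch_false hx' _ => simp [hx] at hx'
    | branch_true hx' _ => simp [hx] at hx'
  | branch_false hx _ ih =>
    cases h₂ with
    | branch_nil hx' g => simp [hx'] at hx
    | branch_false _ g =>
      rcases ih g with ⟨rfl, rfl, rfl⟩ | hd
      · exact .inl ⟨rfl, rfl, rfl⟩
      · exact .inr hd
    | branch_true hx' _ => simp [hx] at hx'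
  | branch_true hx _ ih =>
    cases h₂ with
    | branch_nil hx' g => simp [hx'] at hx
    | branch_false hx' _ => simp [hx] at hx'
    | branch_true _ g =>
      rcases ih g with ⟨rfl, rfl, rfl⟩ | hd
      · exact .inl ⟨rfl, rfl, rfl⟩
      · exact .inr hd
  | loop_done hx =>
    cases h₂ with
    | loop_done _ => exact .inl ⟨rfl, rfl, rfl⟩
    | loop_step hx' _ _ => exact absurd hx hx'
  | loop_step hx _ _ ih₁ ih₂ =>
    cases h₂ with
    | loop_done hx' => exact absurd hx' hx
    | loop_step _ g₁ g₂ =>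
      rcases ih₁ g₁ with ⟨rfl, rfl, rfl⟩ | hd
      · rcases ih₂ g₂ with ⟨rfl, rfl, rfl⟩ | hd
        · exact .inl ⟨rfl, rfl, rfl⟩
        · exact .inr (hd.append_left _)
      · exact .inr (hd.append _ _)
  | call _ ih =>
    cases h₂ with
    | call g =>
      rcases ih g with ⟨rfl, rfl, rfl⟩ | hd
      · exact .inl ⟨rfl, rfl, rfl⟩
      · exact .inr hd

theorem length_trace_le (h : Eval O c s s₁ t₁ tr₁) : tr₁.length ≤ t₁ := by
  induction h <;> (try simp only [List.length_nil, List.length_cons, List.length_append]) <;> omega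

end Eval

/-- Registers grow by at most one bit in each step. -/
theorem Eval.length_le {O : ℕ → Str → Str} {c : Cmd} {s s₁ : Store} {t : ℕ}
    {tr : List (ℕ × Str)} (h : Eval O c s s₁ t tr) {L : ℕ} (hL : ∀ x, (s x).length ≤ L) :
    ∀ x, (s₁ x).length ≤ L + t := by
  have key : ∀ (s : Store) (y : ℕ) (v : Str) (L t : ℕ), (∀ x, (s x).length ≤ L) →
      v.length ≤ L + t → ∀ x, (Function.update s y v x).length ≤ L + t := by
    intro s y v L t hs hv x
    by_cases hx : x = y
    · subst hx; simpa using hv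
    · simpa [hx] using (hs x).trans (Nat.le_add_right _ _)
  induction h generalizing L with
  | skip s => exact fun x => (hL x).trans (Nat.le_add_right _ _)
  | push b y s => exact key _ _ _ _ _ hL (by simpa using hL y)
  | pop y s => exact key _ _ _ _ _ hL (by have := hL y; simp; omega)
  | copy y z s => exact key _ _ _ _ _ hL (by have := hL y; omega)
  | query k y z s => exact key _ _ _ _ _ hL (by omega)
  | seq _ _ ih₁ ih₂ => exact fun x => (ih₂ (ih₁ hL) x).trans (by omega)
  | branch_nil _ _ ih => exact fun x => (ih hL x).trans (by omega)
  | branch_false _ _ ih => exact fun x => (ih hL x).trans (by omega)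
  | branch_true _ _ ih => exact fun x => (ih hL x).trans (by omega)
  | loop_done _ => exact fun x => (hL x).trans (Nat.le_add_right _ _)
  | loop_step _ _ _ ih₁ ih₂ => exact fun x => (ih₂ (ih₁ hL) x).trans (by omega)
  | call _ ih => exact key _ _ _ _ _ hL (by omega)

theorem length_inputStore_le (ins : List Str) (x : ℕ) :
    (inputStore ins x).length ≤ (ins.map List.length).sum := by
  unfold inputStore
  by_cases h : x < ins.length
  · rw [List.getD_eq_getElem _ _ h]
    exact List.le_sum_of_mem (List.mem_map_of_mem (List.getElem_mem h))
  · rw [List.getD_eq_default _ _ (not_lt.1 h)]; exact Nat.zero_le _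

/-- The outputs of a polynomial-time algorithm on inputs of polynomial length have polynomial
length. -/
theorem PolyTime.exists_length_le {ι : ℕ → Type} {input : ∀ n, ι n → List Str}
    {output : ∀ n, ι n → Str} (h : PolyTime input output) (q : Polynomial ℕ)
    (hq : ∀ n i, ((input n i).map List.length).sum ≤ q.eval n) :
    ∃ p : Polynomial ℕ, ∀ n i, (output n i).length ≤ p.eval n := by
  obtain ⟨c, p, h⟩ := h
  refine ⟨Polynomial.X + q + p, fun n i => ?_⟩
  obtain ⟨s, t, tr, he, ht, hs⟩ := h n (fun _ _ => [], i)
  have := he.length_le (length_inputStore_le _) 0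
  have := hq n i
  simp only [hs, List.map_cons, List.length_replicate, List.sum_cons] at *
  simp only [Polynomial.eval_add, Polynomial.eval_X]
  omega

theorem fnOracle_ofFn {a b : ℕ} (g : Bits a → Bits b) (x : Bits a) :
    fnOracle g (List.ofFn x) = List.ofFn (g x) := by
  simp [fnOracle]

/-- A call of a subprogram that passes registers as the inputs of the subprogram. -/
theorem Eval.call_of_eq {O : ℕ → Str → Str} {c : Cmd} {args : List (ℕ × ℕ)} {y : ℕ}
    {s s' : Store} {t : ℕ} {tr : List (ℕ × Str)} {ins : List Str}
    (h : Eval O c (inputStore ins) s' t tr) (hs : callStore s args = inputStore ins) :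
    Eval O (.call c args y) s (Function.update s y (s' 0))
      (t + (args.map fun p => (s p.2).length).sum + (s' 0).length + 1) tr :=
  .call (hs ▸ h)

theorem callStore_two (s : Store) (a b : ℕ) :
    callStore s [(0, a), (1, b)] = inputStore [s a, s b] := by
  funext i
  rcases i with _ | _ | i <;> simp [callStore, inputStore, Function.update]

theorem callStore_three (s : Store) (a b c : ℕ) :
    callStore s [(0, a), (1, b), (2, c)] = inputStore [s a, s b, s c] := by
  funext i
  rcases i with _ | _ | _ | i <;> simp [callStore, inputStore, Function.update]

theorem callStore_four (s : Store) (a b c d : ℕ) :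
    callStore s [(0, a), (1, b), (2, c), (3, d)] = inputStore [s a, s b, s c, s d] := by
  funext i
  rcases i with _ | _ | _ | _ | i <;> simp [callStore, inputStore, Function.update]

/-- Move the bits of register `x`, one by one, to the top of register `y`. -/
def Cmd.moveRev (x y : ℕ) : Cmd :=
  .loop x (.seq (.branch x .skip (.push false y) (.push true y)) (.pop x))

theorem Eval.moveRev {O : ℕ → Str → Str} {x y : ℕ} (hxy : x ≠ y) (s : Store) :
    Eval O (.moveRev x y) s
      (Function.update (Function.update s x []) y ((s x).reverse ++ s y))
      (4 * (s x).length + 1) [] := by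
  generalize hl : s x = l
  induction l generalizing s with
  | nil =>
    have h : Function.update (Function.update s x []) y ([].reverse ++ s y) = s := by
      have h' : Function.update s x [] = s := by rw [← hl, Function.update_eq_self]
      simp [h']
    rw [h]
    exact .loop_done hl
  | cons b l ih =>
    have hstep : Eval O (.seq (.branch x .skip (.push false y) (.push true y)) (.pop x)) s
        (Function.update (Function.update s y (b :: s y)) x l) 3 [] := by
      have hp : Eval O (.pop x) (Function.update s y (b :: s y))
          (Function.update (Function.update s y (b :: s y)) x l) 1 [] := by
        have := Eval.pop (O := O) x (Function.update s y (b :: s y))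
        simpa [hxy, hl] using this
      cases b
      · exact .seq (.branch_false (by simp [hl]) (.push _ _ _)) hp
      · exact .seq (.branch_true (by simp [hl]) (.push _ _ _)) hp
    have hrec := ih (Function.update (Function.update s y (b :: s y)) x l) (by simp)
    have h := Eval.loop_step (by simp [hl]) hstep hrec
    have e1 : Function.update (Function.update (Function.update
        (Function.update s y (b :: s y)) x l) x []) y
          (l.reverse ++ Function.update (Function.update s y (b :: s y)) x l y) =
        Function.update (Function.update s x []) y ((b :: l).reverse ++ s y) := by
      rw [Function.update_of_ne hxy.symm, Function.update_self, Function.update_idem,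
        Function.update_comm hxy, Function.update_idem, Function.update_comm hxy.symm]
      simp
    have e2 : 3 + (4 * l.length + 1) + 1 = 4 * (b :: l).length + 1 := by
      simp; omega
    rw [e1, e2] at h
    exact h

/-! ### Running a program with simulated oracles -/

/-- The program `c` with its queries to oracle number `k` replaced by calls of the program `h k`,
which gets the strings in the registers `1` and `3` as additional inputs.  Register `x` of `c`
becomes register `2 * x`, and the registers `1` and `3` are passed on to all subprograms. -/
def Cmd.simulate (h : ℕ → Cmd) : Cmd → Cmd
  | .skip => .skip
  | .push b x => .push b (2 * x)
  | .pop x => .pop (2 * x)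
  | .copy x y => .copy (2 * x) (2 * y)
  | .query k x y => .call (h k) [(0, 1), (1, 2 * x), (2, 3)] (2 * y)
  | .seq c d => .seq (c.simulate h) (d.simulate h)
  | .branch x c d e => .branch (2 * x) (c.simulate h) (d.simulate h) (e.simulate h)
  | .loop x c => .loop (2 * x) (c.simulate h)
  | .call c args y => .call (c.simulate h)
      ((1, 1) :: (3, 3) :: args.map fun p => (2 * p.1, 2 * p.2)) (2 * y)

/-- The store `s'` of the simulating program represents the store `s`, and holds the additional
inputs `u` and `v`. -/
structure SimStore (u v : Str) (s s' : Store) : Prop where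
  left : s' 1 = u
  right : s' 3 = v
  even : ∀ x, s' (2 * x) = s x

theorem SimStore.update {u v : Str} {s s' : Store} (h : SimStore u v s s') (x : ℕ) (w : Str) :
    SimStore u v (Function.update s x w) (Function.update s' (2 * x) w) where
  left := by rw [Function.update_of_ne (by omega), h.left]
  right := by rw [Function.update_of_ne (by omega), h.right]
  even y := by
    by_cases hy : y = x
    · simp [hy]
    · rw [Function.update_of_ne hy, Function.update_of_ne (by omega), h.even]

theorem SimStore.callStore {u v : Str} {s s' : Store} (h : SimStore u v s s')
    (args : List (ℕ × ℕ)) :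
    SimStore u v (callStore s args)
      (callStore s' ((1, 1) :: (3, 3) :: args.map fun p => (2 * p.1, 2 * p.2))) := by
  have key : ∀ (args : List (ℕ × ℕ)) (a a' : Store), SimStore u v a a' →
      SimStore u v (args.foldl (fun s' p => Function.update s' p.1 (s p.2)) a)
        ((args.map fun p => (2 * p.1, 2 * p.2)).foldl
          (fun s'' p => Function.update s'' p.1 (s' p.2)) a') := by
    intro args
    induction args with
    | nil => exact fun a a' ha => ha
    | cons p args ih =>
      intro a a' ha
      refine ih _ _ ?_
      dsimp only
      rw [h.even]
      exact ha.update _ _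
  refine key args _ _ ⟨?_, ?_, fun x => ?_⟩
  · simp [Function.update, h.left]
  · simp [Function.update, h.right]
  · dsimp only
    rw [Function.update_of_ne (by omega), Function.update_of_ne (by omega)]

/-- If the programs `h k` compute the answers of the oracles `O'` to all well-formed queries in
time `K`, then `c.simulate h` computes what `c` computes with access to `O'`. -/
theorem Eval.simulate {O O' : ℕ → Str → Str} {h : ℕ → Cmd} {u v : Str} {K : ℕ}
    {W : ℕ × Str → Prop}
    (hW : ∀ k q, W (k, q) → ∃ s t tr, Eval O (h k) (inputStore [u, q, v]) s t tr ∧ t ≤ K ∧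
      s 0 = O' k q)
    {c : Cmd} {s s₁ : Store} {t : ℕ} {tr : List (ℕ × Str)} (he : Eval O' c s s₁ t tr)
    (htr : ∀ q ∈ tr, W q) {s' : Store} (hs : SimStore u v s s') :
    ∃ s₁' t' tr', Eval O (c.simulate h) s' s₁' t' tr' ∧ SimStore u v s₁ s₁' ∧
      t' ≤ (K + u.length + v.length + 1) * t := by
  induction he generalizing s' with
  | skip s => exact ⟨_, _, _, .skip _, hs, by nlinarith⟩
  | push b x s =>
    refine ⟨_, _, _, .push _ _ _, ?_, by nlinarith⟩
    rw [hs.even]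
    exact hs.update _ _
  | pop x s =>
    refine ⟨_, _, _, .pop _ _, ?_, by nlinarith⟩
    rw [hs.even]
    exact hs.update _ _
  | copy x y s =>
    refine ⟨_, _, _, .copy _ _ _, ?_, ?_⟩
    · rw [hs.even]
      exact hs.update _ _
    · rw [hs.even]
      exact Nat.le_mul_of_pos_left _ (by omega)
  | query k x y s =>
    obtain ⟨s₂, t₂, tr₂, h₂, ht₂, hs₂⟩ := hW k (s x) (htr _ (by simp))
    refine ⟨_, _, _, .call_of_eq (ins := [u, s x, v]) h₂ ?_, ?_, ?_⟩
    · rw [callStore_three, hs.left, hs.right, hs.even]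
    · rw [hs₂]
      exact hs.update _ _
    · simp only [List.map_cons, List.map_nil, List.sum_cons, List.sum_nil, hs.left, hs.right,
        hs.even, hs₂]
      nlinarith
  | seq _ _ ih₁ ih₂ =>
    obtain ⟨s₂, t₂, tr₂, h₂, hs₂, ht₂⟩ := ih₁ (fun q hq => htr q (by simp [hq])) hs
    obtain ⟨s₃, t₃, tr₃, h₃, hs₃, ht₃⟩ := ih₂ (fun q hq => htr q (by simp [hq])) hs₂
    exact ⟨_, _, _, .seq h₂ h₃, hs₃, by rw [mul_add]; omega⟩
  | branch_nil hx _ ih =>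
    obtain ⟨s₂, t₂, tr₂, h₂, hs₂, ht₂⟩ := ih htr hs
    exact ⟨_, _, _, .branch_nil (by rw [hs.even, hx]) h₂, hs₂, by rw [mul_add]; omega⟩
  | branch_false hx _ ih =>
    obtain ⟨s₂, t₂, tr₂, h₂, hs₂, ht₂⟩ := ih htr hs
    exact ⟨_, _, _, .branch_false (by rw [hs.even, hx]) h₂, hs₂, by rw [mul_add]; omega⟩
  | branch_true hx _ ih =>
    obtain ⟨s₂, t₂, tr₂, h₂, hs₂, ht₂⟩ := ih htr hs
    exact ⟨_, _, _, .branch_true (by rw [hs.even, hx]) h₂, hs₂, by rw [mul_add]; omega⟩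
  | loop_done hx => exact ⟨_, _, _, .loop_done (by rw [hs.even, hx]), hs, by omega⟩
  | loop_step hx _ _ ih₁ ih₂ =>
    obtain ⟨s₂, t₂, tr₂, h₂, hs₂, ht₂⟩ := ih₁ (fun q hq => htr q (by simp [hq])) hs
    obtain ⟨s₃, t₃, tr₃, h₃, hs₃, ht₃⟩ := ih₂ (fun q hq => htr q (by simp [hq])) hs₂
    exact ⟨_, _, _, .loop_step (by rw [hs.even]; exact hx) h₂ h₃, hs₃,
      by rw [mul_add, mul_add]; omega⟩
  | @call c args y s s₁ t tr _ ih =>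
    obtain ⟨s₂, t₂, tr₂, h₂, hs₂, ht₂⟩ := ih htr (hs.callStore args)
    have h0 : s₂ 0 = s₁ 0 := hs₂.even 0
    refine ⟨_, _, _, .call h₂, ?_, ?_⟩
    · rw [h0]
      exact hs.update _ _
    · simp only [List.map_cons, List.sum_cons, List.map_map, Function.comp_def, hs.left, hs.right,
        hs.even, h0]
      generalize (args.map fun p => (s p.2).length).sum = S₁
      generalize (s₁ 0).length = S₂
      have h1 := Nat.le_mul_of_pos_right (K + u.length + v.length) (S₁ + S₂).succ_pos
      nlinarith

/-! ### Efficiency of the reduction -/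

namespace PSF

variable (F : PSF)

theorem exists_pkLen_le : ∃ p : Polynomial ℕ, ∀ n, F.pkLen n ≤ p.eval n := by
  obtain ⟨p, hp⟩ := F.gen_pk_ppt.exists_length_le F.genCoins fun n i => by simp
  exact ⟨p, fun n => by simpa using hp n fun _ => false⟩

theorem exists_domLen_le : ∃ p : Polynomial ℕ, ∀ n, F.domLen n ≤ p.eval n := by
  obtain ⟨p, hp⟩ := F.sample_ppt.exists_length_le F.sampleCoins fun n i => by simp
  exact ⟨p, fun n => by simpa using hp n fun _ => false⟩

theorem exists_ranLen_le : ∃ p : Polynomial ℕ, ∀ n, F.ranLen n ≤ p.eval n := by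
  obtain ⟨p₁, hp₁⟩ := F.exists_pkLen_le
  obtain ⟨p₂, hp₂⟩ := F.exists_domLen_le
  obtain ⟨p, hp⟩ := F.f_ppt.exists_length_le (p₁ + p₂) fun n i => by
    simpa using add_le_add (hp₁ n) (hp₂ n)
  exact ⟨p, fun n => by simpa using hp n (fun _ => false, fun _ => false)⟩

/-- A program that samples with the coins which the shared oracle assigns to the string in register
`1`, and stores the result in register `5`. -/
theorem exists_sample_query (ℓ : Polynomial ℕ) : ∃ (c : Cmd) (p : Polynomial ℕ),
    ∀ n (Oc : Bits (ℓ.eval n) → Bits (F.sampleCoins.eval n)) (m : Bits (ℓ.eval n)) (s : Store),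
      s 0 = List.replicate n true → s 1 = List.ofFn m →
      ∃ t tr, Eval (oneOracle Oc) c s
        (Function.update s 5 (List.ofFn (F.sample n (Oc m)))) t tr ∧ t ≤ p.eval n := by
  obtain ⟨c, p, h⟩ := F.sample_ppt
  obtain ⟨q, hq⟩ := F.exists_domLen_le
  refine ⟨.seq (.query 0 1 5) (.call c [(0, 0), (1, 5)] 5),
    ℓ + F.sampleCoins + p + Polynomial.X + F.sampleCoins + q + 2, fun n Oc m s h0 h1 => ?_⟩
  obtain ⟨s', t, tr, he, ht, hs'⟩ := h n (oneOracle Oc, Oc m)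
  have e := Eval.query (O := oneOracle Oc) 0 1 5 s
  have e5 : oneOracle Oc 0 (s 1) = List.ofFn (Oc m) := by
    rw [h1]; exact fnOracle_ofFn _ _
  rw [e5] at e
  have e' := Eval.call_of_eq (y := 5) (s := Function.update s 5 (List.ofFn (Oc m)))
    (args := [(0, 0), (1, 5)]) he (by rw [callStore_two]; simp [h0])
  rw [Function.update_idem, hs'] at e'
  refine ⟨_, _, .seq e e', ?_⟩
  have := hq n
  simp [h0, h1]
  omega

end PSF

section Efficiency

variable (F : PSF) (ℓ : Polynomial ℕ)

theorem polyTime_copy {ι : ℕ → Type} {len : ℕ → ℕ} (p : Polynomial ℕ) (hp : ∀ n, len n ≤ p.eval n)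
    (x : ∀ n, ι n → Bits (len n)) :
    PolyTime (fun n i => [List.ofFn (x n i)]) (fun n i => List.ofFn (x n i)) := by
  refine ⟨.copy 1 0, p + 1, fun n i => ⟨_, _, _, .copy _ _ _, ?_, ?_⟩⟩
  · simpa [inputStore] using hp n
  · simp [inputStore]

theorem psfReduction_efficient : (psfReduction F ℓ).Efficient := by
  obtain ⟨ppk, hpk⟩ := F.exists_pkLen_le
  obtain ⟨pdom, hdom⟩ := F.exists_domLen_le
  obtain ⟨pran, hran⟩ := F.exists_ranLen_le
  obtain ⟨cs, ps, hs⟩ := F.exists_sample_query ℓ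
  obtain ⟨cf, pf, hf⟩ := F.f_ppt
  have hcopy : PolyTime (ι := fun n => Bits (F.pkLen n)) (fun _ x => [List.ofFn x])
    (fun _ x => List.ofFn x) := polyTime_copy ppk hpk fun _ x => x
  refine ⟨hcopy, hcopy, ?_, ?_, ?_, hcopy⟩
  · refine ⟨.seq cs (.call cf [(0, 0), (1, 2), (2, 5)] 0),
      ps + pf + Polynomial.X + ppk + pdom + pran + 1, ?_⟩
    rintro n ⟨Oc, r, z⟩
    dsimp only [psfReduction, fdhPSF, collisionProblem] at Oc r z ⊢
    obtain ⟨t₁, tr₁, e₁, ht₁⟩ := hs n Oc r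
      (inputStore [List.replicate n true, List.ofFn r, List.ofFn z])
      (by simp [inputStore]) (by simp [inputStore])
    obtain ⟨s₂, t₂, tr₂, e₂, ht₂, hs₂⟩ := hf n (oneOracle Oc, z, F.sample n (Oc r))
    refine ⟨_, _, _, .seq e₁ (.call_of_eq e₂ ?_), ?_, ?_⟩
    · rw [callStore_three]
      simp [inputStore]
    · have := hpk n
      have := hdom n
      have := hran n
      simp [inputStore, hs₂]
      omega
    · simp [hs₂]
  · refine ⟨.seq cs (.seq (.copy 5 0) (.push true 0)), ps + pdom + 2, ?_⟩
    rintro n ⟨Oc, m, z⟩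
    dsimp only [psfReduction, fdhPSF, collisionProblem] at Oc m z ⊢
    obtain ⟨t₁, tr₁, e₁, ht₁⟩ := hs n Oc m
      (inputStore [List.replicate n true, List.ofFn m, List.ofFn z])
      (by simp [inputStore]) (by simp [inputStore])
    refine ⟨_, _, _, .seq e₁ (.seq (.copy _ _ _) (.push _ _ _)), ?_, ?_⟩
    · have := hdom n
      simp
      omega
    · simp [encOption]
  -- Moving the sampled preimage twice, the second time on top of `σ`, restores its order.
  · refine ⟨.seq cs (.seq (.moveRev 5 6) (.seq (.moveRev 6 2) (.copy 2 0))),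
      ps + (4 * pdom + 1) + (4 * pdom + 1) + (pdom + pdom + 1), ?_⟩
    rintro n ⟨Oc, m, σ, z⟩
    dsimp only [psfReduction, fdhPSF, collisionProblem] at Oc m σ z ⊢
    obtain ⟨t₁, tr₁, e₁, ht₁⟩ := hs n Oc m
      (inputStore [List.replicate n true, List.ofFn m, List.ofFn σ, List.ofFn z])
      (by simp [inputStore]) (by simp [inputStore])
    refine ⟨_, _, _, .seq e₁ (.seq (.moveRev (by decide) _)
      (.seq (.moveRev (by decide) _) (.copy _ _ _))), ?_, ?_⟩
    · have := hdom n
      simp [inputStore]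
      omega
    · simp [inputStore]

end Efficiency

namespace Adversary

variable {S : SigScheme} (A : Adversary S) (n : ℕ) (O : Bits (S.hIn n) → Bits (S.hOut n))
  (T : Bits (S.msgLen n) → Bits (S.sigLen n)) (pk : Bits (S.pkLen n)) (r : Bits (A.time.eval n))

theorem attack_spec : ∃ t, S.Attack A.prog n O T pk (List.ofFn r) (List.ofFn (A.msg n O T pk r))
    (List.ofFn (A.sig n O T pk r)) t (A.trace n O T pk r) ∧ t ≤ A.time.eval n :=
  ⟨_, (A.runs n O T pk r).choose_spec.choose_spec.choose_spec.choose_spec⟩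

end Adversary

section Solver

variable (F : PSF) (ℓ : Polynomial ℕ)

theorem psfReduction_noAbort (A : Adversary (fdhPSF F ℓ)) (n : ℕ) (x : Bits (F.pkLen n))
    (Oc : (psfReduction F ℓ).COracle n) (r : Bits (A.time.eval n)) :
    (psfReduction F ℓ).NoAbort A n x Oc r := fun _ _ => by simp [psfReduction]

theorem psfReduction_solver_efficient (A : Adversary (fdhPSF F ℓ)) : OraclePolyTime
    (ι := fun n => (psfReduction F ℓ).COracle n × Bits ((collisionProblem F).instLen n) ×
      Bits (A.time.eval n))
    (fun _ i => oneOracle i.1) (fun _ i => [List.ofFn i.2.1, List.ofFn i.2.2])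
    (fun n i => encOption ((psfReduction F ℓ).solver A n i.2.1 i.1 i.2.2)) := by
  obtain ⟨ppk, hpk⟩ := F.exists_pkLen_le
  obtain ⟨pdom, hdom⟩ := F.exists_domLen_le
  obtain ⟨ch, ph, hh⟩ := (psfReduction_efficient F ℓ).rand
  obtain ⟨cs, ps, hs⟩ := (psfReduction_efficient F ℓ).sign
  obtain ⟨cf, pf, hf⟩ := (psfReduction_efficient F ℓ).finish
  -- SIGN answers with the encoding of `some σ`, whose first bit is dropped.
  let h : ℕ → Cmd := fun k => if k = 0 then ch else .seq cs (.pop 0)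
  -- The copies arrange the inputs `1ⁿ`, `pk`, `r` in the even registers, as the simulation needs
  -- them, and `1ⁿ` and `pk` again in the registers `1` and `3`.
  refine ⟨.seq (.copy 2 4) (.seq (.copy 1 2) (.seq (.copy 1 3) (.seq (.copy 0 1)
    (.seq (A.prog.simulate h)
      (.seq (.call cf [(0, 1), (1, 0), (2, 2), (3, 3)] 0) (.push true 0)))))),
    (A.time + 1) + ((ppk + 1) + ((ppk + 1) + ((Polynomial.X + 1) +
      ((ph + ps + 1 + Polynomial.X + ppk + 1) * A.time +
        ((pf + (Polynomial.X + ℓ + pdom + ppk) + (2 * pdom) + 1) + 1))))), ?_⟩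
  rintro n ⟨Oc, pk, r⟩
  dsimp only at Oc pk r ⊢
  set O := (psfReduction F ℓ).simHash n pk Oc with hO
  set T := (psfReduction F ℓ).simSign n pk Oc with hT
  obtain ⟨t, ⟨⟨s₁, e₁, hm, hσ⟩, hwf⟩, ht⟩ := A.attack_spec n O T pk r
  have hW : ∀ k q, ((∃ x : Bits ((fdhPSF F ℓ).hIn n), (k, q) = (0, List.ofFn x)) ∨
      ∃ x : Bits ((fdhPSF F ℓ).msgLen n), (k, q) = (1, List.ofFn x)) →
      ∃ s t tr, Eval (oneOracle Oc) (h k)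
        (inputStore [List.replicate n true, q, List.ofFn pk]) s t tr ∧
        t ≤ ph.eval n + ps.eval n + 1 ∧ s 0 = twoOracles O T k q := by
    rintro k q (⟨x, hx⟩ | ⟨x, hx⟩) <;> obtain ⟨rfl, rfl⟩ := Prod.mk.inj hx
    · obtain ⟨s, t, tr, e, ht, hs⟩ := hh n (Oc, x, pk)
      refine ⟨s, t, tr, e, by omega, hs.trans (fnOracle_ofFn O x).symm⟩
    · obtain ⟨s, t, tr, e, ht, hs⟩ := hs n (Oc, x, pk)
      refine ⟨_, _, _, .seq e (.pop _ _), by omega, ?_⟩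
      have hs' : s 0 = true :: List.ofFn (F.sample n (Oc x)) := hs
      rw [Function.update_self, hs']
      exact (fnOracle_ofFn T x).symm
  let s₀ : Store := inputStore [List.replicate n true, List.ofFn pk, List.ofFn r]
  let s₀' : Store := Function.update (Function.update (Function.update (Function.update
    s₀ 4 (s₀ 2)) 2 (s₀ 1)) 3 (s₀ 1)) 1 (s₀ 0)
  have e₀ : ∀ i, s₀ (i + 3) = [] := fun i => rfl
  have hsim : SimStore (List.replicate n true) (List.ofFn pk) s₀ s₀' := by
    refine ⟨by simp [s₀', s₀, inputStore], by simp [s₀', s₀, inputStore], fun x => ?_⟩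
    rcases x with _ | _ | _ | x
    · simp [s₀', s₀, inputStore]
    · simp [s₀', s₀, inputStore]
    · simp [s₀', s₀, inputStore]
    · have h1 : s₀' (2 * (x + 3)) = s₀ (2 * (x + 3)) := by
        simp only [s₀']
        rw [Function.update_of_ne (by omega), Function.update_of_ne (by omega),
          Function.update_of_ne (by omega), Function.update_of_ne (by omega)]
      rw [h1, e₀, show 2 * (x + 3) = (2 * x + 3) + 3 by ring, e₀]
  obtain ⟨s₂, t₂, tr₂, e₂, hs₂, ht₂⟩ := e₁.simulate hW hwf hsim
  obtain ⟨s₃, t₃, tr₃, e₃, ht₃, hs₃⟩ := hf n (Oc, A.msg n O T pk r, A.sig n O T pk r, pk)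
  have h0 : s₂ 0 = List.ofFn (A.msg n O T pk r) := (hs₂.even 0).trans hm
  have h2 : s₂ 2 = List.ofFn (A.sig n O T pk r) := (hs₂.even 1).trans hσ
  have eA := Eval.copy (O := oneOracle Oc) 2 4 s₀
  have eB := Eval.copy (O := oneOracle Oc) 1 2 (Function.update s₀ 4 (s₀ 2))
  have eC := Eval.copy (O := oneOracle Oc) 1 3
    (Function.update (Function.update s₀ 4 (s₀ 2)) 2 (s₀ 1))
  have eD := Eval.copy (O := oneOracle Oc) 0 1
    (Function.update (Function.update (Function.update s₀ 4 (s₀ 2)) 2 (s₀ 1)) 3 (s₀ 1))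
  refine ⟨_, _, _, .seq eA (.seq eB (.seq eC (.seq eD (.seq e₂ (.seq
    (.call_of_eq e₃ (by rw [callStore_four, h0, h2, hs₂.left, hs₂.right]; rfl)) (.push _ _ _)))))),
    ?_, ?_⟩
  · have l1 : (s₀ 1).length = F.pkLen n := by simp [s₀, inputStore, collisionProblem]
    have l2 : (s₀ 2).length = A.time.eval n := by simp [s₀, inputStore]
    have l0 : (s₀ 0).length = n := by simp [s₀, inputStore]
    have l3 : (s₃ 0).length = F.domLen n + F.domLen n := by
      rw [hs₃]; simp [collisionProblem]
    simp only [Function.update_of_ne (show (1 : ℕ) ≠ 4 by decide),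
      Function.update_of_ne (show (1 : ℕ) ≠ 2 by decide),
      Function.update_of_ne (show (0 : ℕ) ≠ 4 by decide),
      Function.update_of_ne (show (0 : ℕ) ≠ 3 by decide),
      Function.update_of_ne (show (0 : ℕ) ≠ 2 by decide), l0, l1, l2, l3, List.map_cons,
      List.map_nil, List.sum_cons, List.sum_nil, h0, h2, hs₂.left, hs₂.right, List.length_ofFn,
      List.length_replicate] at ht₂ ⊢
    have hpk' : (collisionProblem F).instLen n ≤ ppk.eval n := hpk n
    have hpk'' : F.pkLen n ≤ ppk.eval n := hpk n
    have hℓ : (fdhPSF F ℓ).msgLen n = ℓ.eval n := rfl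
    have hσ' : (fdhPSF F ℓ).sigLen n ≤ pdom.eval n := hdom n
    have hd := hdom n
    have ht₂' : t₂ ≤ (ph.eval n + ps.eval n + 1 + n + ppk.eval n + 1) * A.time.eval n :=
      ht₂.trans (Nat.mul_le_mul (by omega) ht)
    simp only [Polynomial.eval_add, Polynomial.eval_mul, Polynomial.eval_X, Polynomial.eval_one,
      Polynomial.eval_ofNat, hℓ]
    omega
  · rw [Function.update_self, Function.update_self, hs₃]
    rw [Reduction.solver, if_pos (psfReduction_noAbort F ℓ A n pk Oc r)]
    rfl

end Solver

/-! ### Adaptive queries to a random function -/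

section Adaptive

variable {α β A B : Type} [Fintype α] [DecidableEq α] [Fintype β] [Fintype A] [Fintype B]
  [Nonempty A] [Nonempty B]

/-- Random functions whose values are independently distributed as `φ` or as `ψ` are distinguished
by an event `g` that is decided by `q` adaptive queries `tr` with probability at most `q` times the
variational distance of `φ` and `ψ`.  The proof conditions on the answer to the first query. -/
theorem abs_prob_sub_prob_le_of_adaptive (φ : A → β) (ψ : B → β) {ε : ℝ}
    (hε : ∑ b, |prob (fun a => φ a = b) - prob (fun a => ψ a = b)| ≤ ε) (q : ℕ)
    (tr : (α → β) → List α) (g : (α → β) → Prop) (hq : ∀ T, (tr T).length ≤ q)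
    (H : ∀ T T', (tr T = tr T' ∧ (g T ↔ g T')) ∨
      ∃ pre x r r', tr T = pre ++ x :: r ∧ tr T' = pre ++ x :: r' ∧ T x ≠ T' x) :
    |prob (fun h : α → A => g (φ ∘ h)) - prob (fun h : α → B => g (ψ ∘ h))| ≤ q * ε := by
  have hε₀ : 0 ≤ ε := (Finset.sum_nonneg fun _ _ => abs_nonneg _).trans hε
  induction q generalizing tr g with
  | zero =>
    -- Without queries, the event is constant.
    have hg : ∀ T T', g T ↔ g T' := by
      intro T T'
      rcases H T T' with h | ⟨pre, x, r, r', h, -⟩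
      · exact h.2
      · have := hq T
        simp [h] at this
    let T₀ : α → β := fun _ => φ (Classical.arbitrary A)
    rw [prob_congr fun h => hg (φ ∘ h) T₀, prob_congr fun h => hg (ψ ∘ h) T₀]
    by_cases h : g T₀ <;> simp [h, prob_true, prob_false]
  | succ q ih =>
    let T₀ : α → β := fun _ => φ (Classical.arbitrary A)
    rcases hT₀ : tr T₀ with _ | ⟨x, r₀⟩
    · have hg : ∀ T, g T ↔ g T₀ := by
        intro T
        rcases H T T₀ with h | ⟨pre, x, r, r', -, h, -⟩
        · exact h.2
        · simp [hT₀] at h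
      rw [prob_congr fun h => hg (φ ∘ h), prob_congr fun h => hg (ψ ∘ h)]
      by_cases h : g T₀ <;> simp [h, prob_true, prob_false] <;> positivity
    · -- All runs start with the same query `x`; condition on its answer.
      have hx : ∀ T, ∃ r, tr T = x :: r := by
        intro T
        rcases H T T₀ with h | ⟨pre, y, r, r', h, h', -⟩
        · exact ⟨r₀, h.1.trans hT₀⟩
        · rw [hT₀] at h'
          rcases pre with _ | ⟨z, pre⟩
          · obtain ⟨rfl, -⟩ := List.cons.inj h'
            exact ⟨r, h⟩
          · obtain ⟨rfl, -⟩ := List.cons.inj h'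
            exact ⟨_, h⟩
      have hrec : ∀ b, |prob (fun h : α → A => g (Function.update (φ ∘ h) x b)) -
          prob (fun h : α → B => g (Function.update (ψ ∘ h) x b))| ≤ q * ε := by
        intro b
        refine ih (fun T => (tr (Function.update T x b)).tail)
          (fun T => g (Function.update T x b)) (fun T => ?_) fun T T' => ?_
        · have := hq (Function.update T x b)
          simp
          omega
        · rcases H (Function.update T x b) (Function.update T' x b) with
            h | ⟨pre, y, r, r', h, h', hne⟩
          · exact .inl ⟨by rw [h.1], h.2⟩
          · rcases pre with _ | ⟨z, pre⟩
            · obtain ⟨r₁, h₁⟩ := hx (Function.update T x b)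
              rw [h₁] at h
              obtain ⟨rfl, -⟩ := List.cons.inj h
              simp at hne
            · refine .inr ⟨pre, y, r, r', by rw [h]; rfl, by rw [h']; rfl, ?_⟩
              by_cases hy : y = x
              · subst hy
                simp at hne
              · simpa [hy] using hne
      have hsplit : ∀ {C : Type} [Fintype C] [Nonempty C] (χ : C → β),
          prob (fun h : α → C => g (χ ∘ h)) = ∑ b, prob (fun a => χ a = b) *
            prob (fun h : α → C => g (Function.update (χ ∘ h) x b)) := by
        intro C _ _ χ
        classical
        rw [← avg_comp_eq_sum χ, prob_eq_avg, avg_update x]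
        simp only [prob_eq_avg, Function.comp_update]
      rw [hsplit φ, hsplit ψ, ← Finset.sum_sub_distrib]
      generalize hp : (fun b => prob fun h : α → A => g (Function.update (φ ∘ h) x b)) = p at *
      have hp' : ∀ b, prob (fun h : α → A => g (Function.update (φ ∘ h) x b)) = p b :=
        fun b => congrFun hp b
      have hp₁ : ∀ b, 0 ≤ p b ∧ p b ≤ 1 := fun b => hp' b ▸ ⟨prob_nonneg _, prob_le_one _⟩
      simp only [hp'] at hrec ⊢
      calc |∑ b, (prob (fun a => φ a = b) * p b - prob (fun a => ψ a = b) *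
            prob (fun h : α → B => g (Function.update (ψ ∘ h) x b)))|
          ≤ ∑ b, |prob (fun a => φ a = b) * p b - prob (fun a => ψ a = b) *
            prob (fun h : α → B => g (Function.update (ψ ∘ h) x b))| :=
            Finset.abs_sum_le_sum_abs _ _
        _ ≤ ∑ b, (|prob (fun a => φ a = b) - prob (fun a => ψ a = b)| +
              prob (fun a => ψ a = b) * (q * ε)) := by
            refine Finset.sum_le_sum fun b _ => ?_
            have e : prob (fun a => φ a = b) * p b - prob (fun a => ψ a = b) *
                prob (fun h : α → B => g (Function.update (ψ ∘ h) x b)) =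
                (prob (fun a => φ a = b) - prob (fun a => ψ a = b)) * p b +
                prob (fun a => ψ a = b) * (p b -
                  prob (fun h : α → B => g (Function.update (ψ ∘ h) x b))) := by ring
            rw [e]
            refine (abs_add_le _ _).trans (add_le_add ?_ ?_)
            · rw [abs_mul, abs_of_nonneg (hp₁ b).1]
              exact mul_le_of_le_one_right (abs_nonneg _) (hp₁ b).2
            · rw [abs_mul, abs_of_nonneg (prob_nonneg _)]
              exact mul_le_mul_of_nonneg_left (hrec b) (prob_nonneg _)
        _ ≤ ε + q * ε := by
            rw [Finset.sum_add_distrib, ← Finset.sum_mul, sum_prob_eq, one_mul]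
            gcongr
        _ = (q + 1 : ℕ) * ε := by push_cast; ring

end Adaptive

section Collision

variable {α A X Y : Type} [Fintype α] [DecidableEq α] [Fintype A] [Nonempty A] [Fintype Y]

/-- If changing a random function `T` at the point `msg T` without changing the value of `f` there
influences neither the event `Φ` nor `msg` nor `sig`, then `sig T` guesses `T (msg T)` with a
probability that the min-entropy of `ψ` given `f ∘ ψ` bounds.  The proof resamples the value of `T`
at the point `msg T`. -/
theorem prob_guess_le (ψ : A → X) (f : X → Y) {ε : ℝ}
    (hε : ∀ x y, prob (fun a => ψ a = x ∧ f (ψ a) = y) ≤ ε * prob (fun a => f (ψ a) = y))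
    (Φ : (α → X) → Prop) (msg : (α → X) → α) (sig : (α → X) → X)
    (hΦ : ∀ T x, Φ T → f x = f (T (msg T)) → Φ (Function.update T (msg T) x) ∧
      msg (Function.update T (msg T) x) = msg T ∧ sig (Function.update T (msg T) x) = sig T) :
    prob (fun h : α → A => Φ (ψ ∘ h) ∧ sig (ψ ∘ h) = ψ (h (msg (ψ ∘ h)))) ≤
      ε * prob (fun h : α → A => Φ (ψ ∘ h)) := by
  classical
  rw [← sum_prob_eq_and (fun h : α → A => msg (ψ ∘ h)) (fun h => Φ (ψ ∘ h)),
    ← sum_prob_eq_and (fun h : α → A => msg (ψ ∘ h))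
      (fun h => Φ (ψ ∘ h) ∧ sig (ψ ∘ h) = ψ (h (msg (ψ ∘ h)))), Finset.mul_sum]
  refine Finset.sum_le_sum fun m _ => ?_
  have hsplit : ∀ E : (α → A) → Prop,
      prob E = avg fun h : α → A => prob fun a => E (Function.update h m a) := by
    intro E
    simp only [prob_eq_avg]
    rw [avg_update m, avg_comm]
  rw [hsplit, hsplit, ← avg_mul_left]
  refine avg_mono fun h => ?_
  rw [← sum_prob_eq_and (fun a => f (ψ a)), ← sum_prob_eq_and (fun a => f (ψ a)), Finset.mul_sum]
  refine Finset.sum_le_sum fun y _ => ?_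
  simp only [Function.comp_update]
  by_cases hex : ∃ a₀, f (ψ a₀) = y ∧ msg (Function.update (ψ ∘ h) m (ψ a₀)) = m ∧
      Φ (Function.update (ψ ∘ h) m (ψ a₀))
  · obtain ⟨a₀, hy, hm, hΦ₀⟩ := hex
    have key : ∀ a, f (ψ a) = y → Φ (Function.update (ψ ∘ h) m (ψ a)) ∧
        msg (Function.update (ψ ∘ h) m (ψ a)) = m ∧
        sig (Function.update (ψ ∘ h) m (ψ a)) = sig (Function.update (ψ ∘ h) m (ψ a₀)) := by
      intro a ha
      have := hΦ _ (ψ a) hΦ₀ (by rw [hm, ha, Function.update_self, hy])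
      simpa [hm] using this
    refine (prob_mono fun a ha => ?_).trans
      ((hε (sig (Function.update (ψ ∘ h) m (ψ a₀))) y).trans_eq ?_)
    · obtain ⟨ha, hm', -, hs⟩ := ha
      rw [hm', Function.update_self, (key a ha).2.2] at hs
      exact ⟨hs.symm, ha⟩
    · congr 1
      exact prob_congr fun a => ⟨fun ha => ⟨ha, (key a ha).2.1, (key a ha).1⟩, fun ha => ha.1⟩
  · have h₀ : ∀ E : A → Prop, (∀ a, ¬ E a) → prob E = 0 := fun E hE => by
      rw [← prob_false (Ω := A)]
      exact prob_congr fun a => by simp [hE a]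
    rw [h₀ _ fun a ha => hex ⟨a, ha.1, ha.2.1, ha.2.2.1⟩, h₀ _ fun a ha => hex ⟨a, ha⟩, mul_zero]

end Collision

/-! ### The distributions of hash values and signatures -/

section Games

variable {Ω Ω' : Type} [Fintype Ω] [Fintype Ω']

theorem prob_prod_right (E : Ω × Ω' → Prop) : prob E = avg fun b => prob fun a => E (a, b) := by
  rw [← prob_equiv (Equiv.prodComm Ω' Ω), prob_prod]
  rfl

end Games

namespace PSF

variable (F : PSF) (n : ℕ)

theorem ran_nonempty : (F.ran n).Nonempty :=
  ⟨_, F.f_mem n (fun _ => false) _ (F.sample_mem n fun _ => false)⟩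

instance : Nonempty ↥(F.ran n) := (F.ran_nonempty n).to_subtype

variable {F n}

theorem prob_f_sample_eq_zero {c : Bits (F.genCoins.eval n)} {y : Bits (F.ranLen n)}
    (hy : y ∉ F.ran n) : prob (fun r => F.f n (F.gen n c).2 (F.sample n r) = y) = 0 := by
  rw [← prob_false (Ω := Bits (F.sampleCoins.eval n))]
  exact prob_congr fun r => ⟨fun h => hy (h ▸ F.f_mem n c _ (F.sample_mem n r)), False.elim⟩

theorem prob_sample_and_eq_zero {c : Bits (F.genCoins.eval n)} {y : Bits (F.ranLen n)}
    (hy : prob (fun r => F.f n (F.gen n c).2 (F.sample n r) = y) = 0) (x : Bits (F.domLen n)) :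
    prob (fun r => F.sample n r = x ∧ F.f n (F.gen n c).2 (F.sample n r) = y) = 0 :=
  le_antisymm ((prob_mono fun _ h => h.2).trans hy.le) (prob_nonneg _)

theorem sum_inv_close {c : Bits (F.genCoins.eval n)} {y : Bits (F.ranLen n)} (hy : y ∈ F.ran n)
    {ε : ℝ} (h : ∑ x ∈ F.dom n, |prob (fun ρ => F.inv n (F.gen n c).1 y ρ = x) -
      prob (fun r => F.sample n r = x ∧ F.f n (F.gen n c).2 (F.sample n r) = y) /
        prob (fun r => F.f n (F.gen n c).2 (F.sample n r) = y)| ≤ ε) :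
    ∑ x, |prob (fun ρ => F.inv n (F.gen n c).1 y ρ = x) -
      prob (fun r => F.sample n r = x ∧ F.f n (F.gen n c).2 (F.sample n r) = y) /
        prob (fun r => F.f n (F.gen n c).2 (F.sample n r) = y)| ≤ ε := by
  refine le_of_eq_of_le (Finset.sum_subset (Finset.subset_univ _) fun x _ hx => ?_).symm h
  rw [prob_congr (E' := fun _ => False), prob_congr (E' := fun _ => False)
    (E := fun r => F.sample n r = x ∧ F.f n (F.gen n c).2 (F.sample n r) = y)]
  · simp [prob_false]
  · exact fun r => ⟨fun h => hx (h.1 ▸ F.sample_mem n r), False.elim⟩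
  · exact fun ρ => ⟨fun h => hx (h ▸ (F.inv_mem n c y hy ρ).1), False.elim⟩

/-- The joint distance of a uniform hash value with its signature, and of a simulated hash value
with its signature; the hash value is determined by the signature. -/
theorem sum_inv_uniform_close {c : Bits (F.genCoins.eval n)} {ε₁ ε₂ : ℝ} (hε₂ : 0 ≤ ε₂)
    (h₁ : ∑ y ∈ F.ran n, |prob (fun r => F.f n (F.gen n c).2 (F.sample n r) = y) -
      1 / ((F.ran n).card : ℝ)| ≤ ε₁)
    (h₂ : ∀ y ∈ F.ran n, prob (fun r => F.f n (F.gen n c).2 (F.sample n r) = y) ≠ 0 →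
      ∑ x ∈ F.dom n, |prob (fun ρ => F.inv n (F.gen n c).1 y ρ = x) -
        prob (fun r => F.sample n r = x ∧ F.f n (F.gen n c).2 (F.sample n r) = y) /
          prob (fun r => F.f n (F.gen n c).2 (F.sample n r) = y)| ≤ ε₂) :
    ∑ x, |prob (fun p : ↥(F.ran n) × Bits (F.invCoins.eval n) =>
        F.inv n (F.gen n c).1 p.1 p.2 = x) - prob (fun r => F.sample n r = x)| ≤ ε₁ + ε₂ := by
  set p : Bits (F.ranLen n) → ℝ :=
    fun y => prob fun r => F.f n (F.gen n c).2 (F.sample n r) = y with hp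
  set J : Bits (F.ranLen n) → Bits (F.domLen n) → ℝ :=
    fun y x => prob fun r => F.sample n r = x ∧ F.f n (F.gen n c).2 (F.sample n r) = y with hJ
  set I : Bits (F.ranLen n) → Bits (F.domLen n) → ℝ :=
    fun y x => prob fun ρ => F.inv n (F.gen n c).1 y ρ = x with hI
  set R : ℝ := ((F.ran n).card : ℝ) with hR
  have hR₀ : 0 < R := by
    rw [hR]
    exact_mod_cast (F.ran_nonempty n).card_pos
  have e₁ : ∀ x, prob (fun p : ↥(F.ran n) × Bits (F.invCoins.eval n) =>
      F.inv n (F.gen n c).1 p.1 p.2 = x) = ∑ y ∈ F.ran n, I y x / R := by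
    intro x
    rw [prob_prod, avg, ← Finset.sum_div, Finset.sum_coe_sort (F.ran n) fun y => I y x,
      Fintype.card_coe]
  have e₂ : ∀ x, prob (fun r => F.sample n r = x) = ∑ y ∈ F.ran n, J y x := by
    intro x
    rw [← sum_prob_eq_and (fun r => F.f n (F.gen n c).2 (F.sample n r))]
    rw [← Finset.sum_subset (Finset.subset_univ (F.ran n))]
    · exact Finset.sum_congr rfl fun y _ => prob_congr fun r => and_comm
    · intro y _ hy
      rw [← prob_sample_and_eq_zero (prob_f_sample_eq_zero hy) x]
      exact prob_congr fun r => and_comm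
  have hsumI : ∀ y, ∑ x, I y x = 1 := fun y => sum_prob_eq _
  have hsumJ : ∀ y, ∑ x, J y x = p y := fun y => sum_prob_eq_and _ _
  have hJ₀ : ∀ y x, 0 ≤ J y x := fun y x => prob_nonneg _
  have hI₀ : ∀ y x, 0 ≤ I y x := fun y x => prob_nonneg _
  have key : ∀ y ∈ F.ran n, ∑ x, |I y x / R - J y x| ≤ |p y - 1 / R| + ε₂ / R := by
    intro y hy
    by_cases hpy : p y = 0
    · have : ∀ x, |I y x / R - J y x| = I y x / R := fun x => by
        rw [show J y x = 0 from prob_sample_and_eq_zero hpy x, sub_zero,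
          abs_of_nonneg (div_nonneg (hI₀ _ _) hR₀.le)]
      simp only [this, ← Finset.sum_div, hsumI, hpy, zero_sub, abs_neg]
      rw [abs_of_pos (by positivity)]
      exact le_add_of_nonneg_right (by positivity)
    · have hp₀ : 0 < p y := lt_of_le_of_ne (prob_nonneg _) (Ne.symm hpy)
      have : ∀ x, |I y x / R - J y x| ≤ J y x / p y * |p y - 1 / R| +
          |I y x - J y x / p y| / R := by
        intro x
        have e : I y x / R - J y x =
            -(J y x / p y * (p y - 1 / R)) + (I y x - J y x / p y) / R := by
          field_simp
          ring
        rw [e]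
        refine (abs_add_le _ _).trans_eq ?_
        rw [abs_neg, abs_mul, abs_of_nonneg (div_nonneg (hJ₀ y x) hp₀.le), abs_div,
          abs_of_pos hR₀]
      refine (Finset.sum_le_sum fun x _ => this x).trans ?_
      rw [Finset.sum_add_distrib, ← Finset.sum_mul, ← Finset.sum_div, ← Finset.sum_div, hsumJ,
        div_self hpy, one_mul]
      gcongr
      exact sum_inv_close hy (h₂ y hy hpy)
  calc _ = ∑ x, |∑ y ∈ F.ran n, (I y x / R - J y x)| := by
        simp only [e₁, e₂, Finset.sum_sub_distrib]
    _ ≤ ∑ x, ∑ y ∈ F.ran n, |I y x / R - J y x| :=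
        Finset.sum_le_sum fun x _ => Finset.abs_sum_le_sum_abs _ _
    _ = ∑ y ∈ F.ran n, ∑ x, |I y x / R - J y x| := Finset.sum_comm
    _ ≤ ∑ y ∈ F.ran n, (|p y - 1 / R| + ε₂ / R) := Finset.sum_le_sum key
    _ ≤ ε₁ + ε₂ := by
        rw [Finset.sum_add_distrib, Finset.sum_const, nsmul_eq_mul, ← hR, mul_div_cancel₀ _ hR₀.ne']
        gcongr

end PSF

/-! ### Forgers in the simulated game -/

namespace Adversary

variable {S : SigScheme} (A : Adversary S) (n : ℕ)

/-- Runs of an adversary with different oracles agree until the same query gets different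
answers. -/
theorem eq_or_diverge (O O' : Bits (S.hIn n) → Bits (S.hOut n))
    (T T' : Bits (S.msgLen n) → Bits (S.sigLen n)) (pk : Bits (S.pkLen n))
    (r : Bits (A.time.eval n)) :
    (A.msg n O T pk r = A.msg n O' T' pk r ∧ A.sig n O T pk r = A.sig n O' T' pk r ∧
      A.trace n O T pk r = A.trace n O' T' pk r) ∨
    Diverge (twoOracles O T) (twoOracles O' T') (A.trace n O T pk r) (A.trace n O' T' pk r) := by
  obtain ⟨t, ⟨⟨s, e, hm, hσ⟩, -⟩, -⟩ := A.attack_spec n O T pk r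
  obtain ⟨t', ⟨⟨s', e', hm', hσ'⟩, -⟩, -⟩ := A.attack_spec n O' T' pk r
  refine (e.eq_or_diverge e').imp_left fun ⟨hs, _, htr⟩ => ⟨?_, ?_, htr⟩
  · exact List.ofFn_injective (by rw [← hm, ← hm', hs])
  · exact List.ofFn_injective (by rw [← hσ, ← hσ', hs])

theorem length_trace_le (O : Bits (S.hIn n) → Bits (S.hOut n))
    (T : Bits (S.msgLen n) → Bits (S.sigLen n)) (pk : Bits (S.pkLen n))
    (r : Bits (A.time.eval n)) : (A.trace n O T pk r).length ≤ A.time.eval n := by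
  obtain ⟨t, ⟨⟨s, e, -⟩, -⟩, ht⟩ := A.attack_spec n O T pk r
  exact e.length_trace_le.trans ht

theorem trace_wellFormed (O : Bits (S.hIn n) → Bits (S.hOut n))
    (T : Bits (S.msgLen n) → Bits (S.sigLen n)) (pk : Bits (S.pkLen n))
    (r : Bits (A.time.eval n)) : ∀ q ∈ A.trace n O T pk r,
      (∃ x : Bits (S.hIn n), q = (0, List.ofFn x)) ∨ ∃ x : Bits (S.msgLen n), q = (1, List.ofFn x) := by
  obtain ⟨t, ⟨-, h⟩, -⟩ := A.attack_spec n O T pk r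
  exact h

end Adversary

section FDH

variable {F : PSF} {ℓ : Polynomial ℕ} (A : Adversary (fdhPSF F ℓ)) (n : ℕ)

section Run

variable (pk : Bits (F.pkLen n)) (r : Bits (A.time.eval n))
  (O O' : Bits (ℓ.eval n) → Bits (F.ranLen n)) (T T' : Bits (ℓ.eval n) → Bits (F.domLen n))

/-- The message of the forgery candidate, given the hash values `O` and the signatures `T`. -/
noncomputable def fdhMsg : Bits (ℓ.eval n) := A.msg n O T pk r

/-- The signature of the forgery candidate, given the hash values `O` and the signatures `T`. -/
noncomputable def fdhSig : Bits (F.domLen n) := A.sig n O T pk r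

/-- The oracle queries of the forger, given the hash values `O` and the signatures `T`. -/
noncomputable def fdhTrace : List (ℕ × Str) := A.trace n O T pk r

/-- The adversary forges, given the hash values `O` and the signatures `T`. -/
def FdhForges : Prop :=
  (1, List.ofFn (fdhMsg A n pk r O T)) ∉ fdhTrace A n pk r O T ∧
    fdhSig A n pk r O T ∈ F.dom n ∧ F.f n pk (fdhSig A n pk r O T) = O (fdhMsg A n pk r O T)

theorem fdh_eq_or_diverge : (fdhMsg A n pk r O T = fdhMsg A n pk r O' T' ∧
      fdhSig A n pk r O T = fdhSig A n pk r O' T' ∧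
      fdhTrace A n pk r O T = fdhTrace A n pk r O' T') ∨
    ∃ pre q l l', fdhTrace A n pk r O T = pre ++ q :: l ∧ fdhTrace A n pk r O' T' = pre ++ q :: l' ∧
      ((∃ x, q = (0, List.ofFn x) ∧ O x ≠ O' x) ∨ ∃ x, q = (1, List.ofFn x) ∧ T x ≠ T' x) := by
  refine (A.eq_or_diverge n O O' T T' pk r).imp_right fun ⟨pre, q, l, l', h, h', hne⟩ =>
    ⟨pre, q, l, l', h, h', ?_⟩
  rcases A.trace_wellFormed n O T pk r q (by rw [h]; simp) with ⟨x, rfl⟩ | ⟨x, rfl⟩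
  · exact .inl ⟨x, rfl, fun hx => hne ((fnOracle_ofFn O x).trans
      ((congrArg List.ofFn hx).trans (fnOracle_ofFn O' x).symm))⟩
  · exact .inr ⟨x, rfl, fun hx => hne ((fnOracle_ofFn T x).trans
      ((congrArg List.ofFn hx).trans (fnOracle_ofFn T' x).symm))⟩

theorem length_fdhTrace_le : (fdhTrace A n pk r O T).length ≤ A.time.eval n :=
  A.length_trace_le n O T pk r

/-- The message that a query asks for. -/
def queryPoint {k : ℕ} (q : ℕ × Str) : Bits k := fun i => q.2.getD i false

theorem queryPoint_ofFn {k : ℕ} (j : ℕ) (x : Bits k) : queryPoint (j, List.ofFn x) = x := by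
  funext i
  simp [queryPoint]

/-- The points at which the signatures `T`, with the hash values that make them valid, decide
whether the adversary forges: the hash and signature queries, and the message of the forgery. -/
noncomputable def fdhPoints : List (Bits (ℓ.eval n)) :=
  (fdhTrace A n pk r (F.f n pk ∘ T) T).map queryPoint ++ [fdhMsg A n pk r (F.f n pk ∘ T) T]

/-- The values of `T` at `fdhPoints` decide, one after the other, which point comes next, and in the
end whether the adversary forges. -/
theorem fdhPoints_adaptive :
    (fdhPoints A n pk r T = fdhPoints A n pk r T' ∧
      (FdhForges A n pk r (F.f n pk ∘ T) T ↔ FdhForges A n pk r (F.f n pk ∘ T') T')) ∨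
    ∃ pre x l l', fdhPoints A n pk r T = pre ++ x :: l ∧
      fdhPoints A n pk r T' = pre ++ x :: l' ∧ T x ≠ T' x := by
  rcases fdh_eq_or_diverge A n pk r (F.f n pk ∘ T) (F.f n pk ∘ T') T T' with
    ⟨hm, hσ, htr⟩ | ⟨pre, q, l, l', h, h', hne⟩
  · by_cases hT : T (fdhMsg A n pk r (F.f n pk ∘ T) T) = T' (fdhMsg A n pk r (F.f n pk ∘ T) T)
    · refine .inl ⟨by rw [fdhPoints, fdhPoints, hm, htr], ?_⟩
      unfold FdhForges
      rw [← hm, ← hσ, ← htr, Function.comp_apply, Function.comp_apply, hT]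
    · exact .inr ⟨_, _, [], [], rfl, by rw [fdhPoints, ← hm, ← htr], hT⟩
  · refine .inr ⟨pre.map queryPoint, queryPoint q,
      l.map queryPoint ++ [fdhMsg A n pk r (F.f n pk ∘ T) T],
      l'.map queryPoint ++ [fdhMsg A n pk r (F.f n pk ∘ T') T'],
      by simp [fdhPoints, h], by simp [fdhPoints, h'], ?_⟩
    rcases hne with ⟨x, rfl, hx⟩ | ⟨x, rfl, hx⟩ <;> rw [queryPoint_ofFn]
    · exact fun hT => hx (congrArg (F.f n pk) hT)
    · exact hx

theorem length_fdhPoints_le : (fdhPoints A n pk r T).length ≤ A.time.eval n + 1 := by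
  simpa [fdhPoints] using length_fdhTrace_le A n pk r (F.f n pk ∘ T) T

/-- A forger that did not ask for a signature of its message `m` has learnt at most the hash value
of `T m`, and does not notice a change of `T m` to another preimage of that value. -/
theorem fdhForges_update (x : Bits (F.domLen n)) (hT : FdhForges A n pk r (F.f n pk ∘ T) T)
    (hx : F.f n pk x = F.f n pk (T (fdhMsg A n pk r (F.f n pk ∘ T) T)))
    (hT' : T' = Function.update T (fdhMsg A n pk r (F.f n pk ∘ T) T) x) :
    FdhForges A n pk r (F.f n pk ∘ T') T' ∧
      fdhMsg A n pk r (F.f n pk ∘ T') T' = fdhMsg A n pk r (F.f n pk ∘ T) T ∧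
      fdhSig A n pk r (F.f n pk ∘ T') T' = fdhSig A n pk r (F.f n pk ∘ T) T := by
  have hO : F.f n pk ∘ T' = F.f n pk ∘ T := by
    rw [hT', Function.comp_update, Function.update_eq_self_iff, hx]
    rfl
  rw [hO]
  rcases fdh_eq_or_diverge A n pk r (F.f n pk ∘ T) (F.f n pk ∘ T) T T' with
    ⟨hm, hσ, htr⟩ | ⟨pre, q, l, l', h, h', ⟨y, rfl, hy⟩ | ⟨y, rfl, hy⟩⟩
  · refine ⟨?_, hm.symm, hσ.symm⟩
    unfold FdhForges at hT ⊢
    rwa [← hm, ← hσ, ← htr]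
  · exact absurd rfl hy
  · by_cases hym : y = fdhMsg A n pk r (F.f n pk ∘ T) T
    · subst hym
      exact absurd (by rw [h]; simp) hT.1
    · rw [hT', Function.update_of_ne hym] at hy
      exact absurd rfl hy

end Run

/-- The real game in terms of the signatures alone, which determine the hash values. -/
theorem advantage_eq : A.advantage n = avg fun c : Bits (F.genCoins.eval n) =>
    avg fun r : Bits (A.time.eval n) =>
      prob fun h : Bits (ℓ.eval n) → ↥(F.ran n) × Bits (F.invCoins.eval n) =>
        FdhForges A n (F.gen n c).2 r
          (F.f n (F.gen n c).2 ∘ (fun p : ↥(F.ran n) × Bits (F.invCoins.eval n) =>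
            F.inv n (F.gen n c).1 p.1 p.2) ∘ h)
          ((fun p : ↥(F.ran n) × Bits (F.invCoins.eval n) =>
            F.inv n (F.gen n c).1 p.1 p.2) ∘ h) := by
  change prob (fun ω : Bits (F.genCoins.eval n) × (Bits (ℓ.eval n) → ↥(F.ran n)) ×
    (Bits (ℓ.eval n) → Bits (F.invCoins.eval n)) × Bits (A.time.eval n) =>
      FdhForges A n (F.gen n ω.1).2 ω.2.2.2 (fun m => (ω.2.1 m : Bits (F.ranLen n)))
        fun m => F.inv n (F.gen n ω.1).1 (ω.2.1 m) (ω.2.2.1 m)) = _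
  rw [prob_prod]
  congr 1
  funext c
  rw [← prob_equiv (Equiv.prodAssoc _ _ _), prob_prod_right]
  congr 1
  funext r
  rw [← prob_equiv (Equiv.arrowProdEquivProdArrow _ _ _)]
  refine prob_congr fun h => ?_
  have hh : (F.f n (F.gen n c).2 ∘ (fun p : ↥(F.ran n) × Bits (F.invCoins.eval n) =>
      F.inv n (F.gen n c).1 p.1 p.2) ∘ h) = fun m => ((h m).1 : Bits (F.ranLen n)) :=
    funext fun m => (F.inv_mem n c _ (h m).1.2 _).2
  rw [hh]
  rfl

theorem simProb_simForges_eq : (psfReduction F ℓ).simProb A n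
      (fun x Oc r => (psfReduction F ℓ).SimForges A n x Oc r) =
    avg fun c : Bits (F.genCoins.eval n) => avg fun r : Bits (A.time.eval n) =>
      prob fun Oc : Bits (ℓ.eval n) → Bits (F.sampleCoins.eval n) =>
        FdhForges A n (F.gen n c).2 r (F.f n (F.gen n c).2 ∘ F.sample n ∘ Oc)
          (F.sample n ∘ Oc) := by
  have h : (psfReduction F ℓ).simProb A n
      (fun x Oc r => (psfReduction F ℓ).SimForges A n x Oc r) =
      prob fun ω : Bits (F.genCoins.eval n) × (Bits (ℓ.eval n) → Bits (F.sampleCoins.eval n)) ×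
        Bits (A.time.eval n) => FdhForges A n (F.gen n ω.1).2 ω.2.2
          (F.f n (F.gen n ω.1).2 ∘ F.sample n ∘ ω.2.1) (F.sample n ∘ ω.2.1) :=
    prob_congr fun ω => and_iff_right (psfReduction_noAbort F ℓ A n _ _ _)
  rw [h, prob_prod]
  congr 1
  funext c
  rw [prob_prod_right]

/-- A forgery `σ` of a message `m` collides with the simulated signature of `m`, unless these are
equal. -/
theorem le_simProb_simForges_and_solves :
    (avg fun c : Bits (F.genCoins.eval n) => avg fun r : Bits (A.time.eval n) =>
      prob fun Oc : Bits (ℓ.eval n) → Bits (F.sampleCoins.eval n) =>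
        FdhForges A n (F.gen n c).2 r (F.f n (F.gen n c).2 ∘ F.sample n ∘ Oc)
          (F.sample n ∘ Oc) ∧
        fdhSig A n (F.gen n c).2 r (F.f n (F.gen n c).2 ∘ F.sample n ∘ Oc) (F.sample n ∘ Oc) ≠
          F.sample n (Oc (fdhMsg A n (F.gen n c).2 r
            (F.f n (F.gen n c).2 ∘ F.sample n ∘ Oc) (F.sample n ∘ Oc)))) ≤
    (psfReduction F ℓ).simProb A n fun x Oc r =>
      (psfReduction F ℓ).SimForges A n x Oc r ∧ (psfReduction F ℓ).Solves A n x Oc r := by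
  have h : (prob fun ω : Bits (F.genCoins.eval n) ×
        (Bits (ℓ.eval n) → Bits (F.sampleCoins.eval n)) × Bits (A.time.eval n) =>
          FdhForges A n (F.gen n ω.1).2 ω.2.2
            (F.f n (F.gen n ω.1).2 ∘ F.sample n ∘ ω.2.1) (F.sample n ∘ ω.2.1) ∧
          fdhSig A n (F.gen n ω.1).2 ω.2.2 (F.f n (F.gen n ω.1).2 ∘ F.sample n ∘ ω.2.1)
              (F.sample n ∘ ω.2.1) ≠
            F.sample n (ω.2.1 (fdhMsg A n (F.gen n ω.1).2 ω.2.2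
              (F.f n (F.gen n ω.1).2 ∘ F.sample n ∘ ω.2.1) (F.sample n ∘ ω.2.1)))) ≤
      (psfReduction F ℓ).simProb A n fun x Oc r =>
        (psfReduction F ℓ).SimForges A n x Oc r ∧ (psfReduction F ℓ).Solves A n x Oc r := by
    refine prob_mono fun ω ⟨hf, hne⟩ => ⟨⟨psfReduction_noAbort F ℓ A n _ _ _, hf⟩, _,
      if_pos (psfReduction_noAbort F ℓ A n _ _ _), ?_⟩
    have e₁ : ∀ a b : Bits (F.domLen n),
        (fun i => Fin.append a b (Fin.castAdd (F.domLen n) i)) = a :=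
      fun a b => funext fun i => Fin.append_left a b i
    have e₂ : ∀ a b : Bits (F.domLen n),
        (fun i => Fin.append a b (Fin.natAdd (F.domLen n) i)) = b :=
      fun a b => funext fun i => Fin.append_right a b i
    have hcol : ∀ x₁ x₂ : Bits (F.domLen n), x₁ ∈ F.dom n → x₂ ∈ F.dom n → x₁ ≠ x₂ →
        F.f n (F.gen n ω.1).2 x₁ = F.f n (F.gen n ω.1).2 x₂ →
        (collisionProblem F).wins n (F.gen n ω.1).2 (Fin.append x₁ x₂) := by
      intro x₁ x₂ h₁ h₂ h₃ h₄
      simp only [collisionProblem, e₁, e₂]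
      exact ⟨h₁, h₂, h₃, h₄⟩
    exact hcol _ _ (F.sample_mem n _) hf.2.1 hne.symm hf.2.2.symm
  refine le_of_eq_of_le ?_ h
  rw [prob_prod]
  congr 1
  funext c
  rw [prob_prod_right]

/-- The min-entropy condition, without the case distinction on the conditioning. -/
theorem prob_sample_and_le {ε : ℝ} {c : Bits (F.genCoins.eval n)}
    (h : ∀ y ∈ F.ran n, prob (fun r => F.f n (F.gen n c).2 (F.sample n r) = y) ≠ 0 →
      ∀ x, prob (fun r => F.sample n r = x ∧ F.f n (F.gen n c).2 (F.sample n r) = y) /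
        prob (fun r => F.f n (F.gen n c).2 (F.sample n r) = y) ≤ ε)
    (x : Bits (F.domLen n)) (y : Bits (F.ranLen n)) :
    prob (fun r => F.sample n r = x ∧ F.f n (F.gen n c).2 (F.sample n r) = y) ≤
      ε * prob (fun r => F.f n (F.gen n c).2 (F.sample n r) = y) := by
  by_cases hp : prob (fun r => F.f n (F.gen n c).2 (F.sample n r) = y) = 0
  · rw [PSF.prob_sample_and_eq_zero hp, hp, mul_zero]
  · have hy : y ∈ F.ran n := by
      by_contra hy
      exact hp (PSF.prob_f_sample_eq_zero hy)
    have hp₀ := lt_of_le_of_ne (prob_nonneg _) (Ne.symm hp)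
    exact (div_le_iff₀ hp₀).1 (h y hy hp x)

variable (F ℓ) in
/-- A valid forgery solves the collision problem, except with the probability of guessing a sampled
preimage. -/
theorem exists_collision_bound : ∃ ε : ℕ → ℝ, Negligible ε ∧ (∀ n, 0 ≤ ε n) ∧
    ∀ (A : Adversary (fdhPSF F ℓ)) n,
      (1 - ε n) * (psfReduction F ℓ).simProb A n
        (fun x Oc r => (psfReduction F ℓ).SimForges A n x Oc r) ≤
      (psfReduction F ℓ).simProb A n fun x Oc r =>
        (psfReduction F ℓ).SimForges A n x Oc r ∧ (psfReduction F ℓ).Solves A n x Oc r := by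
  classical
  obtain ⟨ε, hε, h⟩ := F.min_entropy
  refine ⟨fun n => |ε n|, hε.abs, fun n => abs_nonneg _, fun A n => ?_⟩
  refine le_trans ?_ (le_simProb_simForges_and_solves A n)
  rw [simProb_simForges_eq, ← avg_mul_left]
  refine avg_mono fun c => ?_
  rw [← avg_mul_left]
  refine avg_mono fun r => ?_
  set pk := (F.gen n c).2
  have hguess := prob_guess_le (α := Bits (ℓ.eval n)) (F.sample n) (F.f n pk)
    (fun x y => (prob_sample_and_le n (h n c) x y).trans
      (mul_le_mul_of_nonneg_right (le_abs_self _) (prob_nonneg _)))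
    (fun T => FdhForges A n pk r (F.f n pk ∘ T) T) (fun T => fdhMsg A n pk r (F.f n pk ∘ T) T)
    (fun T => fdhSig A n pk r (F.f n pk ∘ T) T)
    (fun T x hT hx => fdhForges_update A n pk r T _ x hT hx (by congr))
  rw [sub_mul, one_mul, sub_le_iff_le_add]
  refine le_trans ?_ (add_le_add_right hguess _)
  simp only [prob_eq_avg, ← avg_add]
  refine avg_mono fun Oc => ?_
  by_cases hf : FdhForges A n pk r (F.f n pk ∘ F.sample n ∘ Oc) (F.sample n ∘ Oc)
  · by_cases hs : fdhSig A n pk r (F.f n pk ∘ F.sample n ∘ Oc) (F.sample n ∘ Oc) =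
        F.sample n (Oc (fdhMsg A n pk r (F.f n pk ∘ F.sample n ∘ Oc) (F.sample n ∘ Oc)))
    · simp [hf, hs]
    · simp [hf, hs]
  · simp [hf]

variable (F ℓ) in
/-- Real and simulated game differ by a negligible amount for each query. -/
theorem exists_hybrid_bound : ∃ ε : ℕ → ℝ, Negligible ε ∧
    ∀ (A : Adversary (fdhPSF F ℓ)) n, A.advantage n ≤ (psfReduction F ℓ).simProb A n
        (fun x Oc r => (psfReduction F ℓ).SimForges A n x Oc r) +
      ((A.time + 1).eval n : ℕ) * ε n := by
  obtain ⟨ε₁, hε₁, h₁⟩ := F.sample_uniform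
  obtain ⟨ε₂, hε₂, h₂⟩ := F.inv_close
  refine ⟨fun n => ε₁ n + |ε₂ n|, hε₁.add hε₂.abs, fun A n => ?_⟩
  rw [advantage_eq, simProb_simForges_eq, ← sub_le_iff_le_add', ← avg_sub,
    ← avg_const (Ω := Bits (F.genCoins.eval n)) (_ * _)]
  refine avg_mono fun c => ?_
  rw [← avg_sub, ← avg_const (Ω := Bits (A.time.eval n)) (_ * _)]
  refine avg_mono fun r => (le_abs_self _).trans ?_
  refine abs_prob_sub_prob_le_of_adaptive _ _
    (PSF.sum_inv_uniform_close (abs_nonneg _) (h₁ n c)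
      fun y hy hp => (h₂ n c y hy hp).trans (le_abs_self _)) _
    (fdhPoints A n (F.gen n c).2 r)
    (fun T => FdhForges A n (F.gen n c).2 r (F.f n (F.gen n c).2 ∘ T) T) (fun T => ?_)
    (fdhPoints_adaptive A n (F.gen n c).2 r)
  simpa using length_fdhPoints_le A n (F.gen n c).2 r T

theorem psfReduction_finish_solves : ∃ δ : ℕ → ℝ, ¬ Negligible δ ∧ ∀ n, 0 ≤ δ n ∧
    δ n * (psfReduction F ℓ).simProb A n
        (fun x Oc r => (psfReduction F ℓ).SimForges A n x Oc r) ≤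
      (psfReduction F ℓ).simProb A n fun x Oc r =>
        (psfReduction F ℓ).SimForges A n x Oc r ∧ (psfReduction F ℓ).Solves A n x Oc r := by
  obtain ⟨ε, hε, -, h⟩ := exists_collision_bound F ℓ
  -- `ε n` may exceed `1` for finitely many `n`.
  refine ⟨fun n => max 0 (1 - ε n), Negligible.not_of_tendsto_one ?_,
    fun n => ⟨le_max_left _ _, ?_⟩⟩
  · have h1 := (tendsto_const_nhds (x := (1 : ℝ))).sub hε.tendsto_zero
    simpa using (tendsto_const_nhds (x := (0 : ℝ))).max h1
  · rcases max_cases 0 (1 - ε n) with ⟨h', -⟩ | ⟨h', -⟩ <;> simp only [h']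
    · rw [zero_mul]
      exact prob_nonneg _
    · exact h A n

theorem psfReduction_security (hA : ¬ Negligible fun n => A.advantage n) :
    ¬ Negligible fun n => (psfReduction F ℓ).simProb A n
      fun x Oc r => (psfReduction F ℓ).Solves A n x Oc r := by
  obtain ⟨ε₁, hε₁, hpos, h₁⟩ := exists_collision_bound F ℓ
  obtain ⟨ε₂, hε₂, h₂⟩ := exists_hybrid_bound F ℓ
  -- With `P` and `Q` the probabilities that `A` forges and that `B` solves, the advantage is at most
  -- `P + (q + 1) * ε₂`, and `P ≤ Q + ε₁ * P ≤ Q + ε₁`.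
  refine fun hneg => hA (((hneg.add hε₁).add
    (hε₂.polynomial_mul (A.time + 1))).of_nonneg_of_le (fun n => prob_nonneg _) fun n => ?_)
  have hP : (psfReduction F ℓ).simProb A n
      (fun x Oc r => (psfReduction F ℓ).SimForges A n x Oc r) ≤ 1 := prob_le_one _
  have hQ : (psfReduction F ℓ).simProb A n (fun x Oc r =>
      (psfReduction F ℓ).SimForges A n x Oc r ∧ (psfReduction F ℓ).Solves A n x Oc r) ≤
      (psfReduction F ℓ).simProb A n fun x Oc r => (psfReduction F ℓ).Solves A n x Oc r :=
    prob_mono fun _ h => h.2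
  nlinarith [h₁ A n, h₂ A n, hpos n]

end FDH

/-! ### Random functions with independent values -/

/-- The expectation of `F h` when the values of the function `h` are independent and have the
distribution `w`. -/
noncomputable def iidAvg {α β : Type} [Fintype α] [DecidableEq α] [Fintype β] (w : β → ℝ)
    (F : (α → β) → ℝ) : ℝ :=
  ∑ h, (∏ x, w (h x)) * F h

section IID

variable {α β γ A : Type} [Fintype α] [DecidableEq α] [Fintype β] [Fintype γ] [Fintype A]

theorem sum_prod_eq_one {w : β → ℝ} (hw : ∑ b, w b = 1) : ∑ h : α → β, ∏ x, w (h x) = 1 := by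
  classical
  have h := Finset.prod_univ_sum (fun _ : α => (Finset.univ : Finset β)) fun _ b => w b
  rw [Fintype.piFinset_univ] at h
  rw [← h]
  simp [hw]

theorem iidAvg_mono {w : β → ℝ} (hw : ∀ b, 0 ≤ w b) {F G : (α → β) → ℝ} (h : ∀ T, F T ≤ G T) :
    iidAvg w F ≤ iidAvg w G :=
  Finset.sum_le_sum fun T _ =>
    mul_le_mul_of_nonneg_left (h T) (Finset.prod_nonneg fun _ _ => hw _)

theorem iidAvg_add (w : β → ℝ) (F G : (α → β) → ℝ) :
    iidAvg w (fun h => F h + G h) = iidAvg w F + iidAvg w G := by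
  simp [iidAvg, mul_add, Finset.sum_add_distrib]

theorem iidAvg_sub (w : β → ℝ) (F G : (α → β) → ℝ) :
    iidAvg w (fun h => F h - G h) = iidAvg w F - iidAvg w G := by
  simp [iidAvg, mul_sub, Finset.sum_sub_distrib]

theorem iidAvg_mul_left (w : β → ℝ) (c : ℝ) (F : (α → β) → ℝ) :
    iidAvg w (fun h => c * F h) = c * iidAvg w F := by
  simp only [iidAvg, Finset.mul_sum]
  exact Finset.sum_congr rfl fun h _ => by ring

theorem iidAvg_sum {ι : Type} (w : β → ℝ) (s : Finset ι) (F : ι → (α → β) → ℝ) :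
    iidAvg w (fun h => ∑ i ∈ s, F i h) = ∑ i ∈ s, iidAvg w (F i) := by
  simp only [iidAvg, Finset.mul_sum]
  exact Finset.sum_comm

theorem abs_iidAvg_le {w : β → ℝ} (hw : ∀ b, 0 ≤ w b) (F : (α → β) → ℝ) :
    |iidAvg w F| ≤ iidAvg w fun h => |F h| := by
  refine (Finset.abs_sum_le_sum_abs _ _).trans_eq (Finset.sum_congr rfl fun h _ => ?_)
  rw [abs_mul, abs_of_nonneg (Finset.prod_nonneg fun _ _ => hw _)]

theorem iidAvg_const {w : β → ℝ} (hw : ∑ b, w b = 1) (c : ℝ) :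
    iidAvg w (fun _ : α → β => c) = c := by
  rw [iidAvg, ← Finset.sum_mul, sum_prod_eq_one hw, one_mul]

open scoped Classical in
/-- The pointwise image of an independent family is an independent family. -/
theorem iidAvg_map {w : γ → ℝ} {μ : β → ℝ} (φ : γ → β)
    (hμ : ∀ b, μ b = ∑ c, if φ c = b then w c else 0) (F : (α → β) → ℝ) :
    iidAvg μ F = iidAvg w fun h => F (φ ∘ h) := by
  have hprod : ∀ O : α → β, ∏ x, μ (O x) =
      ∑ h : α → γ, if φ ∘ h = O then ∏ x, w (h x) else 0 := by
    intro O
    simp only [hμ]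
    rw [Finset.prod_univ_sum, Fintype.piFinset_univ]
    refine Finset.sum_congr rfl fun h _ => ?_
    by_cases hO : φ ∘ h = O
    · rw [if_pos hO]
      refine Finset.prod_congr rfl fun x _ => if_pos ?_
      rw [← hO]
      rfl
    · rw [if_neg hO]
      obtain ⟨x, hx⟩ := Function.ne_iff.1 hO
      exact Finset.prod_eq_zero (Finset.mem_univ x) (if_neg hx)
  simp only [iidAvg, hprod, Finset.sum_mul]
  rw [Finset.sum_comm]
  refine Finset.sum_congr rfl fun h _ => ?_
  simp

theorem iidAvg_prod (κ : β → ℝ) (ν : γ → ℝ) (F : (α → β × γ) → ℝ) :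
    iidAvg (fun p : β × γ => κ p.1 * ν p.2) F =
      iidAvg κ fun K => iidAvg ν fun N => F fun x => (K x, N x) := by
  simp only [iidAvg, Finset.mul_sum]
  rw [← Fintype.sum_prod_type', ← (Equiv.arrowProdEquivProdArrow α _ _).symm.sum_comp]
  refine Finset.sum_congr rfl fun p _ => ?_
  simp [Finset.prod_mul_distrib, mul_assoc, Equiv.arrowProdEquivProdArrow]

theorem iidAvg_apply {w : β → ℝ} (hw : ∑ b, w b = 1) (x : α) (F : β → ℝ) :
    iidAvg w (fun h => F (h x)) = ∑ b, w b * F b := by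
  have h := Finset.prod_univ_sum (fun _ : α => (Finset.univ : Finset β))
    fun y b => w b * if y = x then F b else 1
  rw [Fintype.piFinset_univ] at h
  rw [iidAvg]
  refine Eq.trans (Finset.sum_congr rfl fun T _ => ?_) (h.symm.trans ?_)
  · rw [Finset.prod_mul_distrib, Finset.prod_ite_eq' Finset.univ x, if_pos (Finset.mem_univ x)]
  · rw [Finset.prod_eq_single x]
    · simp
    · intro y _ hy
      simp [hy, hw]
    · simp

theorem avg_comp_eq_iidAvg (φ : A → β) (F : (α → β) → ℝ) :
    (avg fun h : α → A => F (φ ∘ h)) = iidAvg (fun b => prob fun a => φ a = b) F := by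
  classical
  rw [iidAvg_map (w := fun _ : A => ((Fintype.card A : ℝ))⁻¹) φ]
  · simp only [avg, iidAvg, Finset.prod_const, Finset.card_univ, ← Finset.mul_sum,
      Fintype.card_fun, Nat.cast_pow, inv_pow, div_eq_inv_mul]
  · intro b
    simp [prob_eq_avg, avg, Finset.sum_ite, div_eq_mul_inv]

theorem sum_mul_sqrt_le {ι : Type} [Fintype ι] {p X : ι → ℝ} (hp : ∀ i, 0 ≤ p i)
    (hp₁ : ∑ i, p i = 1) (hX : ∀ i, 0 ≤ X i) : ∑ i, p i * √(X i) ≤ √(∑ i, p i * X i) := by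
  have h := Real.strictConcaveOn_sqrt.concaveOn.le_map_sum (t := Finset.univ) (w := p) (p := X)
    (fun i _ => hp i) hp₁ fun i _ => hX i
  simpa using h

/-- Jensen's inequality for the square root. -/
theorem iidAvg_sqrt_le {w : β → ℝ} (hw : ∀ b, 0 ≤ w b) (hw₁ : ∑ b, w b = 1) {F : (α → β) → ℝ}
    (hF : ∀ h, 0 ≤ F h) : iidAvg w (fun h => √(F h)) ≤ √(iidAvg w F) :=
  sum_mul_sqrt_le (fun _ => Finset.prod_nonneg fun _ _ => hw _) (sum_prod_eq_one hw₁) hF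

end IID

/-! ### Unitarity of the gates -/

section Gates

variable {a b w : ℕ}

/-- The Euclidean norm of a state vector. -/
noncomputable def qNorm (ψ : QState a b w) : ℝ := ‖WithLp.toLp 2 ψ‖

theorem qNorm_sq (ψ : QState a b w) : qNorm ψ ^ 2 = ∑ s, Complex.normSq (ψ s) := by
  rw [qNorm, EuclideanSpace.norm_sq_eq]
  simp [Complex.normSq_eq_norm_sq]

theorem qNorm_eq_sqrt (ψ : QState a b w) : qNorm ψ = √(∑ s, Complex.normSq (ψ s)) := by
  rw [← qNorm_sq, qNorm, Real.sqrt_sq (norm_nonneg _)]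

theorem qNorm_add_le (ψ φ : QState a b w) : qNorm (ψ + φ) ≤ qNorm ψ + qNorm φ :=
  norm_add_le (WithLp.toLp 2 ψ) (WithLp.toLp 2 φ)

theorem xorAnswer_involutive (O : Bits a → Bits b) :
    Function.Involutive (xorAnswer (w := w) O) := by
  intro s
  funext i
  rcases i with i | i | i <;> simp [xorAnswer]

theorem QGate.apply_sub (O : Bits a → Bits b) (g : QGate a b w) (ψ φ : QState a b w) :
    g.apply O (ψ - φ) = g.apply O ψ - g.apply O φ := by
  cases g <;> funext s <;> simp only [QGate.apply, Pi.sub_apply] <;> ring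

theorem sum_eq_sum_update {ι : Type} [Fintype ι] [DecidableEq ι] (i : ι) (F : (ι → Bool) → ℝ) :
    2 * ∑ s, F s = ∑ s, (F (Function.update s i false) + F (Function.update s i true)) := by
  have h := sum_sum_update (β := Bool) i fun _ => F
  rw [Fintype.sum_bool, Fintype.sum_bool] at h
  rw [Finset.sum_add_distrib]
  linarith

theorem normSq_hadamard (x y : ℂ) :
    Complex.normSq (((Real.sqrt 2 : ℝ) : ℂ)⁻¹ * (x + y)) +
      Complex.normSq (((Real.sqrt 2 : ℝ) : ℂ)⁻¹ * (x + -1 * y)) =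
    Complex.normSq x + Complex.normSq y := by
  have h : Complex.normSq ((Real.sqrt 2 : ℝ) : ℂ)⁻¹ = 1 / 2 := by
    rw [Complex.normSq_inv, Complex.normSq_ofReal, Real.mul_self_sqrt (by norm_num)]
    norm_num
  simp only [Complex.normSq_mul, h]
  simp only [Complex.normSq_apply, Complex.add_re, Complex.add_im, Complex.mul_re, Complex.mul_im,
    Complex.neg_re, Complex.neg_im, Complex.one_re, Complex.one_im]
  ring

theorem QGate.qNorm_apply (O : Bits a → Bits b) (g : QGate a b w) (ψ : QState a b w) :
    qNorm (g.apply O ψ) = qNorm ψ := by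
  rw [qNorm_eq_sqrt, qNorm_eq_sqrt]
  congr 1
  cases g with
  | hadamard i =>
    refine mul_left_cancel₀ (two_ne_zero (α := ℝ)) ?_
    rw [sum_eq_sum_update i, sum_eq_sum_update i]
    refine Finset.sum_congr rfl fun s _ => ?_
    simp only [QGate.apply, Function.update_idem, Function.update_self, Bool.false_eq_true,
      if_false, if_true, one_mul]
    exact normSq_hadamard _ _
  | phase i =>
    refine Finset.sum_congr rfl fun s _ => ?_
    by_cases h : s i <;> simp [QGate.apply, h]
  | piEighth i =>
    refine Finset.sum_congr rfl fun s _ => ?_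
    have he : Complex.normSq (Complex.exp (Complex.I * Real.pi / 4)) = 1 := by
      rw [Complex.normSq_eq_norm_sq,
        show Complex.I * Real.pi / 4 = ((Real.pi / 4 : ℝ) : ℂ) * Complex.I by push_cast; ring,
        Complex.norm_exp_ofReal_mul_I, one_pow]
    by_cases h : s i <;> simp [QGate.apply, h, he]
  | cnot c t h =>
    have hi : Function.Involutive
        fun s : Wire a b w → Bool => Function.update s t (xor (s t) (s c)) := by
      intro s
      simp [Function.update_of_ne h]
    exact Equiv.sum_comp hi.toPerm fun s => Complex.normSq (ψ s)
  | oracle => exact Equiv.sum_comp (xorAnswer_involutive O).toPerm fun s => Complex.normSq (ψ s)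

theorem finalState_append (circ : List (QGate a b w)) (g : QGate a b w) (O : Bits a → Bits b) :
    finalState (circ ++ [g]) O = g.apply O (finalState circ O) := by
  simp [finalState]

theorem qNorm_finalState (circ : List (QGate a b w)) (O : Bits a → Bits b) :
    qNorm (finalState circ O) = 1 := by
  induction circ using List.reverseRecOn with
  | nil =>
    rw [qNorm_eq_sqrt, Finset.sum_eq_single (fun _ => false)]
    · simp [finalState]
    · intro s _ hs
      simp [finalState, hs]
    · simp
  | append_singleton circ g ih => rw [finalState_append, QGate.qNorm_apply, ih]

open scoped Classical in
/-- Replacing the oracle `O` by `K` affects the part of the state only in which a point of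
disagreement is queried. -/
theorem QGate.qNorm_apply_sub_apply_le (O K : Bits a → Bits b) (S : Bits a → Prop)
    (hS : ∀ x, ¬ S x → O x = K x) (g : QGate a b w) (ψ : QState a b w) :
    qNorm (g.apply O ψ - g.apply K ψ) ≤
      2 * √(∑ s, Complex.normSq (ψ s) * if S (fun i => s (.inl i)) then 1 else 0) := by
  have hzero : qNorm (0 : QState a b w) = 0 := norm_zero
  cases g with
  | oracle =>
    have h2 : (2 : ℝ) = √4 := by
      rw [show (4 : ℝ) = 2 ^ 2 by norm_num, Real.sqrt_sq (by norm_num)]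
    rw [qNorm_eq_sqrt, h2, ← Real.sqrt_mul (by norm_num)]
    refine Real.sqrt_le_sqrt ?_
    let P : (Wire a b w → Bool) → ℝ :=
      fun s => Complex.normSq (ψ s) * if S (fun i => s (.inl i)) then 1 else 0
    have hP : ∀ O' : Bits a → Bits b, ∑ s, P (xorAnswer O' s) = ∑ s, P s :=
      fun O' => Equiv.sum_comp (xorAnswer_involutive O').toPerm P
    have hsum : 4 * ∑ s, P s = ∑ s, (2 * P (xorAnswer O s) + 2 * P (xorAnswer K s)) := by
      rw [Finset.sum_add_distrib, ← Finset.mul_sum, ← Finset.mul_sum, hP, hP]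
      ring
    refine le_of_le_of_eq (Finset.sum_le_sum fun s _ => ?_) hsum.symm
    have hq : ∀ O' : Bits a → Bits b,
        (fun i => xorAnswer O' s (.inl i)) = fun i => s (.inl i) := fun _ => rfl
    simp only [P, hq, Pi.sub_apply, QGate.apply]
    by_cases hs : S fun i => s (.inl i)
    · simp only [hs, if_true, mul_one, Complex.normSq_apply, Complex.sub_re, Complex.sub_im]
      nlinarith [sq_nonneg ((ψ (xorAnswer O s)).re + (ψ (xorAnswer K s)).re),
        sq_nonneg ((ψ (xorAnswer O s)).im + (ψ (xorAnswer K s)).im)]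
    · have hx : xorAnswer O s = xorAnswer K s := by
        funext i
        rcases i with i | i | i <;> simp [xorAnswer, hS _ hs]
      simp [hs, hx]
  | _ =>
    simp only [QGate.apply, sub_self, hzero]
    positivity

end Gates

/-! ### Quantum access to random functions -/

section Oracle

variable {a b w : ℕ}

/-- For `h x = (K x, N x)`, the function with values `K x`, except at the points `x` at which `N`
prescribes another value. -/
def overwrite {α β : Type} (h : α → β × Option β) : α → β := fun x => (h x).2.getD (h x).1

/-- A quantum algorithm hardly notices that a random function `K` is overwritten on a sparse random
set of points, which is independent of `K`: in each query, the weight of the overwritten points in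
the state is `ε` on average. -/
theorem iidAvg_qNorm_sub_le {κ : Bits b → ℝ} {ν : Option (Bits b) → ℝ} {ε : ℝ}
    (hκ : ∀ y, 0 ≤ κ y) (hκ₁ : ∑ y, κ y = 1) (hν : ∀ y, 0 ≤ ν y) (hν₁ : ∑ y, ν y = 1)
    (hε : ∑ y, ν (some y) = ε) (circ : List (QGate a b w)) :
    iidAvg (fun p : Bits b × Option (Bits b) => κ p.1 * ν p.2)
      (fun h : Bits a → Bits b × Option (Bits b) =>
        qNorm (finalState circ (overwrite h) - finalState circ (Prod.fst ∘ h))) ≤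
      2 * circ.length * √ε := by
  classical
  have hw : ∀ p : Bits b × Option (Bits b), 0 ≤ κ p.1 * ν p.2 :=
    fun p => mul_nonneg (hκ _) (hν _)
  have hw₁ : ∑ p : Bits b × Option (Bits b), κ p.1 * ν p.2 = 1 := by
    rw [Fintype.sum_prod_type]
    simp only [← Finset.mul_sum, hν₁, mul_one, hκ₁]
  induction circ using List.reverseRecOn with
  | nil =>
    have h0 : qNorm (0 : QState a b w) = 0 := norm_zero
    simp [finalState, h0, iidAvg]
  | append_singleton circ g ih =>
    have hstep : ∀ h : Bits a → Bits b × Option (Bits b),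
        qNorm (finalState (circ ++ [g]) (overwrite h) -
          finalState (circ ++ [g]) (Prod.fst ∘ h)) ≤
        qNorm (finalState circ (overwrite h) - finalState circ (Prod.fst ∘ h)) +
          2 * √(∑ s, Complex.normSq (finalState circ (Prod.fst ∘ h) s) *
            if (h fun i => s (.inl i)).2 ≠ none then 1 else 0) := by
      intro h
      have e : finalState (circ ++ [g]) (overwrite h) - finalState (circ ++ [g]) (Prod.fst ∘ h) =
          g.apply (overwrite h) (finalState circ (overwrite h) - finalState circ (Prod.fst ∘ h)) +
          (g.apply (overwrite h) (finalState circ (Prod.fst ∘ h)) -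
            g.apply (Prod.fst ∘ h) (finalState circ (Prod.fst ∘ h))) := by
        rw [finalState_append, finalState_append, QGate.apply_sub]
        abel
      rw [e]
      refine (qNorm_add_le _ _).trans (add_le_add (QGate.qNorm_apply _ _ _).le ?_)
      refine (QGate.qNorm_apply_sub_apply_le (overwrite h) (Prod.fst ∘ h)
        (fun x => (h x).2 ≠ none) (fun x hx => ?_) g _).trans (by congr!)
      rw [not_not] at hx
      simp [overwrite, hx]
    refine (iidAvg_mono hw hstep).trans ?_
    rw [iidAvg_add, iidAvg_mul_left]
    have hsq : iidAvg (fun p : Bits b × Option (Bits b) => κ p.1 * ν p.2)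
        (fun h : Bits a → Bits b × Option (Bits b) =>
          ∑ s, Complex.normSq (finalState circ (Prod.fst ∘ h) s) *
            if (h fun i => s (.inl i)).2 ≠ none then 1 else 0) = ε := by
      rw [iidAvg_prod]
      have hin : ∀ K : Bits a → Bits b, (iidAvg ν fun N : Bits a → Option (Bits b) =>
          ∑ s, Complex.normSq (finalState circ K s) *
            if N (fun i => s (.inl i)) ≠ none then (1 : ℝ) else 0) = ε := by
        intro K
        rw [iidAvg_sum]
        have hs : ∀ s : Wire a b w → Bool, (iidAvg ν fun N : Bits a → Option (Bits b) =>
            Complex.normSq (finalState circ K s) *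
              if N (fun i => s (.inl i)) ≠ none then (1 : ℝ) else 0) =
            Complex.normSq (finalState circ K s) * ε := by
          intro s
          rw [iidAvg_mul_left,
            iidAvg_apply hν₁ (fun i => s (.inl i)) fun y => if y ≠ none then (1 : ℝ) else 0,
            Fintype.sum_option, ← hε]
          simp
        simp only [hs]
        rw [← Finset.sum_mul, ← qNorm_sq, qNorm_finalState, one_pow, one_mul]
      refine Eq.trans ?_ (iidAvg_const (α := Bits a) hκ₁ ε)
      congr 1
      funext K
      exact hin K
    have hj := iidAvg_sqrt_le (α := Bits a) hw hw₁
      (F := fun h => ∑ s, Complex.normSq (finalState circ (Prod.fst ∘ h) s) *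
            if (h fun i => s (.inl i)).2 ≠ none then 1 else 0)
      (fun h => Finset.sum_nonneg fun s _ => mul_nonneg (Complex.normSq_nonneg _)
        (by split_ifs <;> norm_num))
    rw [hsq] at hj
    rw [List.length_append, List.length_singleton]
    push_cast
    linarith

theorem sum_abs_normSq_sub_le (ψ φ : QState a b w) (hψ : qNorm ψ = 1) (hφ : qNorm φ = 1) :
    ∑ s, |Complex.normSq (ψ s) - Complex.normSq (φ s)| ≤ 2 * qNorm (ψ - φ) := by
  have hs : ∀ s, |Complex.normSq (ψ s) - Complex.normSq (φ s)| ≤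
      ‖(ψ - φ) s‖ * ‖ψ s‖ + ‖(ψ - φ) s‖ * ‖φ s‖ := by
    intro s
    rw [Complex.normSq_eq_norm_sq, Complex.normSq_eq_norm_sq,
      show ‖ψ s‖ ^ 2 - ‖φ s‖ ^ 2 = (‖ψ s‖ - ‖φ s‖) * (‖ψ s‖ + ‖φ s‖) by ring, abs_mul,
      abs_of_nonneg (by positivity : 0 ≤ ‖ψ s‖ + ‖φ s‖), ← mul_add]
    gcongr
    exact abs_norm_sub_norm_le _ _
  have hcs : ∀ f g : QState a b w, ∑ s, ‖f s‖ * ‖g s‖ ≤ qNorm f * qNorm g := by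
    intro f g
    have := Real.sum_mul_le_sqrt_mul_sqrt Finset.univ (fun s => ‖f s‖) fun s => ‖g s‖
    simpa only [qNorm_eq_sqrt, Complex.normSq_eq_norm_sq] using this
  refine (Finset.sum_le_sum fun s _ => hs s).trans ?_
  rw [Finset.sum_add_distrib]
  have h1 := hcs (ψ - φ) ψ
  have h2 := hcs (ψ - φ) φ
  rw [hψ] at h1
  rw [hφ] at h2
  linarith

/-- Random functions whose values have the distribution `κ`, or a distribution `μ` that contains
`κ` with weight `1 - ε`, are hard to distinguish with quantum queries. -/
theorem sum_abs_iidAvg_sub_le {κ μ : Bits b → ℝ} {ε : ℝ} (hκ : ∀ y, 0 ≤ κ y)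
    (hκ₁ : ∑ y, κ y = 1) (hμ₁ : ∑ y, μ y = 1) (hε : ε ≤ 1) (h : ∀ y, (1 - ε) * κ y ≤ μ y)
    (circ : List (QGate a b w)) :
    ∑ s, |iidAvg μ (fun O : Bits a → Bits b => Complex.normSq (finalState circ O s)) -
      iidAvg κ (fun O : Bits a → Bits b => Complex.normSq (finalState circ O s))| ≤
      4 * circ.length * √ε := by
  classical
  -- `none` leaves the value from `κ`, and `some y` accounts for the rest of `μ`.
  let ν : Option (Bits b) → ℝ := fun y => y.elim (1 - ε) fun y => μ y - (1 - ε) * κ y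
  have hν : ∀ y, 0 ≤ ν y := by
    rintro (_ | y)
    · exact sub_nonneg.2 hε
    · exact sub_nonneg.2 (h y)
  have hνε : ∑ y, ν (some y) = ε := by
    simp only [ν, Option.elim, Finset.sum_sub_distrib, ← Finset.mul_sum, hκ₁, hμ₁]
    ring
  have hν₁ : ∑ y, ν y = 1 := by
    rw [Fintype.sum_option, hνε]
    simp [ν]
  have hw : ∀ p : Bits b × Option (Bits b), 0 ≤ κ p.1 * ν p.2 :=
    fun p => mul_nonneg (hκ _) (hν _)
  have hmapμ : ∀ F : (Bits a → Bits b) → ℝ, iidAvg μ F =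
      iidAvg (fun p : Bits b × Option (Bits b) => κ p.1 * ν p.2) fun h => F (overwrite h) := by
    intro F
    refine iidAvg_map (fun p : Bits b × Option (Bits b) => p.2.getD p.1) (fun y => ?_) F
    rw [Fintype.sum_prod_type]
    simp only [Fintype.sum_option, Option.getD_none, Option.getD_some]
    have h₁ : ∑ k, (if k = y then κ k * ν none else 0) = (1 - ε) * κ y := by
      simp [ν, mul_comm]
    have h₂ : ∑ k, ∑ m, (if m = y then κ k * ν (some m) else 0) = ν (some y) := by
      simp [← Finset.sum_mul, hκ₁]
    rw [Finset.sum_add_distrib, h₁, h₂]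
    simp [ν]
  have hmapκ : ∀ F : (Bits a → Bits b) → ℝ, iidAvg κ F =
      iidAvg (fun p : Bits b × Option (Bits b) => κ p.1 * ν p.2) fun h => F (Prod.fst ∘ h) := by
    intro F
    refine iidAvg_map Prod.fst (fun y => ?_) F
    rw [Fintype.sum_prod_type, Finset.sum_eq_single y]
    · simp [← Finset.mul_sum, hν₁]
    · intro z _ hz
      simp [hz]
    · simp
  calc _ = ∑ s, |iidAvg (fun p : Bits b × Option (Bits b) => κ p.1 * ν p.2)
          fun h : Bits a → Bits b × Option (Bits b) =>
            Complex.normSq (finalState circ (overwrite h) s) -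
              Complex.normSq (finalState circ (Prod.fst ∘ h) s)| := by
        simp only [hmapμ, hmapκ, iidAvg_sub]
    _ ≤ ∑ s, iidAvg (fun p : Bits b × Option (Bits b) => κ p.1 * ν p.2)
          fun h : Bits a → Bits b × Option (Bits b) =>
            |Complex.normSq (finalState circ (overwrite h) s) -
              Complex.normSq (finalState circ (Prod.fst ∘ h) s)| :=
        Finset.sum_le_sum fun s _ => abs_iidAvg_le hw _
    _ = iidAvg (fun p : Bits b × Option (Bits b) => κ p.1 * ν p.2)
          fun h : Bits a → Bits b × Option (Bits b) =>
            ∑ s, |Complex.normSq (finalState circ (overwrite h) s) -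
              Complex.normSq (finalState circ (Prod.fst ∘ h) s)| := (iidAvg_sum _ _ _).symm
    _ ≤ iidAvg (fun p : Bits b × Option (Bits b) => κ p.1 * ν p.2)
          fun h : Bits a → Bits b × Option (Bits b) =>
            2 * qNorm (finalState circ (overwrite h) - finalState circ (Prod.fst ∘ h)) :=
        iidAvg_mono hw fun h => sum_abs_normSq_sub_le _ _ (qNorm_finalState _ _)
          (qNorm_finalState _ _)
    _ ≤ 4 * circ.length * √ε := by
        rw [iidAvg_mul_left]
        have := iidAvg_qNorm_sub_le (a := a) (w := w) hκ hκ₁ hν hν₁ hνε circ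
        linarith

/-- Two distributions at variational distance `2 * ε` contain a common distribution with weight
`1 - ε`. -/
theorem exists_common_part {β : Type} [Fintype β] {μ ν : β → ℝ} (hμ : ∀ y, 0 ≤ μ y)
    (hν : ∀ y, 0 ≤ ν y) (hμ₁ : ∑ y, μ y = 1) (hν₁ : ∑ y, ν y = 1) :
    ∃ κ : β → ℝ, (∀ y, 0 ≤ κ y) ∧ ∑ y, κ y = 1 ∧ (∑ y, |μ y - ν y|) / 2 ≤ 1 ∧
      (∀ y, (1 - (∑ y, |μ y - ν y|) / 2) * κ y ≤ μ y) ∧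
      ∀ y, (1 - (∑ y, |μ y - ν y|) / 2) * κ y ≤ ν y := by
  have hmin : ∑ y, min (μ y) (ν y) = 1 - (∑ y, |μ y - ν y|) / 2 := by
    have h : ∀ y, min (μ y) (ν y) = (μ y + ν y - |μ y - ν y|) / 2 := by
      intro y
      rcases le_total (μ y) (ν y) with hy | hy
      · rw [min_eq_left hy, abs_of_nonpos (by linarith)]
        ring
      · rw [min_eq_right hy, abs_of_nonneg (by linarith)]
        ring
    simp only [h, ← Finset.sum_div, Finset.sum_sub_distrib, Finset.sum_add_distrib, hμ₁, hν₁]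
    ring
  have hmin₀ : ∀ y, 0 ≤ min (μ y) (ν y) := fun y => le_min (hμ y) (hν y)
  have hm := Finset.sum_nonneg fun y (_ : y ∈ Finset.univ) => hmin₀ y
  rw [← hmin]
  have hle : (∑ y, |μ y - ν y|) / 2 ≤ 1 := by linarith
  by_cases h0 : ∑ y, min (μ y) (ν y) = 0
  · -- The distributions have disjoint supports, so that the weight of `κ` is zero.
    exact ⟨μ, hμ, hμ₁, hle, fun y => by rw [h0, zero_mul]; exact hμ y,
      fun y => by rw [h0, zero_mul]; exact hν y⟩
  · refine ⟨fun y => min (μ y) (ν y) / ∑ y, min (μ y) (ν y), fun y => div_nonneg (hmin₀ y) hm,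
      ?_, hle, fun y => ?_, fun y => ?_⟩
    · rw [← Finset.sum_div, div_self h0]
    · rw [mul_div_cancel₀ _ h0]
      exact min_le_left _ _
    · rw [mul_div_cancel₀ _ h0]
      exact min_le_right _ _

theorem outputProb_eq_iidAvg {A : Type} [Fintype A] (φ : A → Bits b)
    (circ : List (QGate a b w)) (s : Wire a b w → Bool) :
    outputProb (fun (h : Bits a → A) x => φ (h x)) circ s =
      iidAvg (fun y => prob fun c => φ c = y)
        fun O : Bits a → Bits b => Complex.normSq (finalState circ O s) := by
  rw [← avg_comp_eq_iidAvg]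
  rfl

/-- Random functions with independent values at small variational distance are hard to distinguish
with quantum queries. -/
theorem sum_abs_outputProb_sub_le {A B : Type} [Fintype A] [Fintype B] [Nonempty A] [Nonempty B]
    (φ : A → Bits b) (ψ : B → Bits b) {ε : ℝ}
    (hε : ∑ y, |prob (fun c => φ c = y) - prob (fun c => ψ c = y)| ≤ ε)
    (circ : List (QGate a b w)) :
    ∑ s, |outputProb (fun (h : Bits a → A) x => φ (h x)) circ s -
      outputProb (fun (h : Bits a → B) x => ψ (h x)) circ s| ≤ 8 * circ.length * √ε := by
  obtain ⟨κ, hκ, hκ₁, hle, hφ, hψ⟩ := exists_common_part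
    (fun y => prob_nonneg fun c => φ c = y) (fun y => prob_nonneg fun c => ψ c = y)
    (sum_prob_eq φ) (sum_prob_eq ψ)
  have h₁ := sum_abs_iidAvg_sub_le (a := a) (w := w) hκ hκ₁ (sum_prob_eq φ) hle hφ circ
  have h₂ := sum_abs_iidAvg_sub_le (a := a) (w := w) hκ hκ₁ (sum_prob_eq ψ) hle hψ circ
  have hs : √((∑ y, |prob (fun c => φ c = y) - prob (fun c => ψ c = y)|) / 2) ≤ √ε := by
    refine Real.sqrt_le_sqrt ?_
    have := Finset.sum_nonneg fun y (_ : y ∈ Finset.univ) =>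
      abs_nonneg (prob (fun c => φ c = y) - prob (fun c => ψ c = y))
    linarith
  have hl : 4 * (circ.length : ℝ) *
      √((∑ y, |prob (fun c => φ c = y) - prob (fun c => ψ c = y)|) / 2) ≤
      4 * circ.length * √ε := by gcongr
  simp only [outputProb_eq_iidAvg]
  refine (Finset.sum_le_sum fun s _ => abs_sub_le _
    (iidAvg κ fun O : Bits a → Bits b => Complex.normSq (finalState circ O s)) _).trans ?_
  rw [Finset.sum_add_distrib]
  simp only [abs_sub_comm (iidAvg κ _)]
  linarith

end Oracle

/-! ### Joint distributions of simulated signatures -/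

section ProductDistance

variable {α : Type} [Fintype α] [DecidableEq α] {γ : α → Type} [∀ m, Fintype (γ m)]

/-- The variational distance of product distributions is at most the sum of the distances of the
factors. -/
theorem sum_abs_prod_sub_prod_le {u v : ∀ m, γ m → ℝ} (hu : ∀ m c, 0 ≤ u m c)
    (hv : ∀ m c, 0 ≤ v m c) (hu₁ : ∀ m, ∑ c, u m c = 1) (hv₁ : ∀ m, ∑ c, v m c = 1) :
    ∑ g : ∀ m, γ m, |∏ m, u m (g m) - ∏ m, v m (g m)| ≤ ∑ m, ∑ c, |u m c - v m c| := by
  have key : ∀ S : Finset α, ∑ g : ∀ m, γ m,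
      |∏ m, u m (g m) - ∏ m, (if m ∈ S then v m (g m) else u m (g m))| ≤
      ∑ m ∈ S, ∑ c, |u m c - v m c| := by
    intro S
    induction S using Finset.induction_on with
    | empty => simp
    | insert a S ha ih =>
      -- Exchanging the factor `a` changes the product to one with a signed factor at `a`.
      let d : ∀ m, γ m → ℝ := fun m c =>
        if m = a then u m c - v m c else if m ∈ S then v m c else u m c
      have hd : ∀ g : ∀ m, γ m, ∏ m, (if m ∈ S then v m (g m) else u m (g m)) -
          ∏ m, (if m ∈ insert a S then v m (g m) else u m (g m)) = ∏ m, d m (g m) := by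
        intro g
        rw [← Finset.mul_prod_erase Finset.univ (fun m => d m (g m)) (Finset.mem_univ a),
          ← Finset.mul_prod_erase Finset.univ (fun m => if m ∈ S then v m (g m) else u m (g m))
            (Finset.mem_univ a),
          ← Finset.mul_prod_erase Finset.univ
            (fun m => if m ∈ insert a S then v m (g m) else u m (g m)) (Finset.mem_univ a)]
        have e₁ : ∏ m ∈ Finset.univ.erase a, (if m ∈ S then v m (g m) else u m (g m)) =
            ∏ m ∈ Finset.univ.erase a, d m (g m) :=
          Finset.prod_congr rfl fun m hm => by simp [d, Finset.ne_of_mem_erase hm]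
        have e₂ : ∏ m ∈ Finset.univ.erase a,
            (if m ∈ insert a S then v m (g m) else u m (g m)) =
            ∏ m ∈ Finset.univ.erase a, d m (g m) :=
          Finset.prod_congr rfl fun m hm => by
            simp [d, Finset.mem_insert, Finset.ne_of_mem_erase hm]
        rw [e₁, e₂, ← sub_mul]
        simp [d, ha]
      have hsum : ∑ g : ∀ m, γ m, |∏ m, d m (g m)| = ∑ c, |u a c - v a c| := by
        simp only [Finset.abs_prod]
        rw [← Fintype.piFinset_univ, ← Finset.prod_univ_sum (fun m => Finset.univ)
          fun m c => |d m c|, Finset.prod_eq_single a]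
        · simp [d]
        · intro m _ hm
          by_cases hS : m ∈ S
          · simp [d, hm, hS, abs_of_nonneg (hv m _), hv₁]
          · simp [d, hm, hS, abs_of_nonneg (hu m _), hu₁]
        · simp
      calc _ ≤ ∑ g : ∀ m, γ m,
            (|∏ m, u m (g m) - ∏ m, (if m ∈ S then v m (g m) else u m (g m))| +
              |∏ m, d m (g m)|) :=
            Finset.sum_le_sum fun g _ => by
              rw [← hd g]
              exact abs_sub_le _ _ _
        _ ≤ _ := by
            rw [Finset.sum_add_distrib, hsum, Finset.sum_insert ha, add_comm]
            gcongr
  simpa using key Finset.univ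

end ProductDistance

theorem prob_prod_and {Ω Ω' : Type} [Fintype Ω] [Fintype Ω'] (E : Ω → Prop) (E' : Ω' → Prop) :
    prob (fun ω : Ω × Ω' => E ω.1 ∧ E' ω.2) = prob E * prob E' := by
  classical
  rw [prob_prod, prob_eq_avg E, mul_comm, ← avg_mul_left]
  congr 1
  funext a
  by_cases h : E a <;> simp [h, prob_false]

section Sign

variable {F : PSF} {ℓ : Polynomial ℕ} {n : ℕ}

/-- For a single message, a simulated hash value with the simulated signature is distributed almost
as the simulated hash value with the signature computed from it. -/
theorem sum_abs_sample_sub_inv_le {c : Bits (F.genCoins.eval n)} {ε : ℝ}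
    (h : ∀ y ∈ F.ran n, prob (fun r => F.f n (F.gen n c).2 (F.sample n r) = y) ≠ 0 →
      ∑ x ∈ F.dom n, |prob (fun ρ => F.inv n (F.gen n c).1 y ρ = x) -
        prob (fun r => F.sample n r = x ∧ F.f n (F.gen n c).2 (F.sample n r) = y) /
          prob (fun r => F.f n (F.gen n c).2 (F.sample n r) = y)| ≤ ε) :
    ∑ y, ∑ x, |prob (fun r => F.f n (F.gen n c).2 (F.sample n r) = y ∧ F.sample n r = x) -
      prob (fun r => F.f n (F.gen n c).2 (F.sample n r) = y) *
        prob (fun ρ => F.inv n (F.gen n c).1 y ρ = x)| ≤ ε := by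
  set p : Bits (F.ranLen n) → ℝ :=
    fun y => prob fun r => F.f n (F.gen n c).2 (F.sample n r) = y with hp
  have hy : ∀ y, ∑ x, |prob (fun r => F.f n (F.gen n c).2 (F.sample n r) = y ∧
      F.sample n r = x) - p y * prob (fun ρ => F.inv n (F.gen n c).1 y ρ = x)| ≤ p y * ε := by
    intro y
    have hcomm : ∀ x, prob (fun r => F.f n (F.gen n c).2 (F.sample n r) = y ∧ F.sample n r = x) =
        prob (fun r => F.sample n r = x ∧ F.f n (F.gen n c).2 (F.sample n r) = y) :=
      fun x => prob_congr fun r => and_comm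
    simp only [hcomm]
    by_cases hpy : p y = 0
    · simp [PSF.prob_sample_and_eq_zero hpy, hpy]
    · have hmem : y ∈ F.ran n := by
        by_contra hmem
        exact hpy (PSF.prob_f_sample_eq_zero hmem)
      have hp₀ : 0 ≤ p y := prob_nonneg _
      refine le_trans (le_of_eq ?_)
        (mul_le_mul_of_nonneg_left (PSF.sum_inv_close hmem (h y hmem hpy)) hp₀)
      rw [Finset.mul_sum]
      refine Finset.sum_congr rfl fun x _ => ?_
      rw [← abs_of_nonneg hp₀, ← abs_mul, abs_of_nonneg hp₀, abs_sub_comm, mul_sub]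
      congr 2
      exact (mul_div_cancel₀ _ hpy).symm
  refine (Finset.sum_le_sum fun y _ => hy y).trans_eq ?_
  rw [← Finset.sum_mul, sum_prob_eq, one_mul]

/-- Hash values together with signatures of the messages in `M` amount to a family of pairs, whose
second component is absent outside of `M`. -/
def hashSignEquiv {α Y X : Type} (M : Finset α) :
    ((α → Y) × (↥M → X)) ≃ ∀ m : α, Y × (m ∈ M → X) where
  toFun p m := (p.1 m, fun h => p.2 ⟨m, h⟩)
  invFun g := (fun m => (g m).1, fun m => (g m).2 m.2)
  left_inv _ := rfl
  right_inv _ := rfl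

theorem sum_abs_sign_sub_le {c : Bits (F.genCoins.eval n)} {ε : ℝ}
    (h : ∀ y ∈ F.ran n, prob (fun r => F.f n (F.gen n c).2 (F.sample n r) = y) ≠ 0 →
      ∑ x ∈ F.dom n, |prob (fun ρ => F.inv n (F.gen n c).1 y ρ = x) -
        prob (fun r => F.sample n r = x ∧ F.f n (F.gen n c).2 (F.sample n r) = y) /
          prob (fun r => F.f n (F.gen n c).2 (F.sample n r) = y)| ≤ ε)
    {k : ℕ} (M : Finset (Bits k)) :
    ∑ H : Bits k → Bits (F.ranLen n), ∑ τ : ↥M → Bits (F.domLen n),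
      |prob (fun Oc : Bits k → Bits (F.sampleCoins.eval n) =>
          (fun m => F.f n (F.gen n c).2 (F.sample n (Oc m))) = H ∧
            ∀ m : ↥M, F.sample n (Oc m) = τ m) -
        prob (fun ω : (Bits k → Bits (F.sampleCoins.eval n)) ×
            (Bits k → Bits (F.invCoins.eval n)) =>
          (fun m => F.f n (F.gen n c).2 (F.sample n (ω.1 m))) = H ∧
            ∀ m : ↥M, F.inv n (F.gen n c).1 (H m) (ω.2 m) = τ m)| ≤ M.card * ε := by
  set pk := (F.gen n c).2
  set sk := (F.gen n c).1
  let u : ∀ m, Bits (F.ranLen n) × (m ∈ M → Bits (F.domLen n)) → ℝ := fun m p =>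
    prob fun r => F.f n pk (F.sample n r) = p.1 ∧ ∀ hm : m ∈ M, F.sample n r = p.2 hm
  let v : ∀ m, Bits (F.ranLen n) × (m ∈ M → Bits (F.domLen n)) → ℝ := fun m p =>
    prob fun ω : Bits (F.sampleCoins.eval n) × Bits (F.invCoins.eval n) =>
      F.f n pk (F.sample n ω.1) = p.1 ∧ ∀ hm : m ∈ M, F.inv n sk p.1 ω.2 = p.2 hm
  have hU : ∀ H τ, prob (fun Oc : Bits k → Bits (F.sampleCoins.eval n) =>
      (fun m => F.f n pk (F.sample n (Oc m))) = H ∧ ∀ m : ↥M, F.sample n (Oc m) = τ m) =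
      ∏ m, u m (hashSignEquiv M (H, τ) m) := by
    intro H τ
    rw [← prob_forall]
    refine prob_congr fun Oc => ⟨fun ⟨h₁, h₂⟩ m => ⟨congrFun h₁ m, fun hm => h₂ ⟨m, hm⟩⟩,
      fun h => ⟨funext fun m => (h m).1, fun m => (h m).2 m.2⟩⟩
  have hV : ∀ H τ, prob (fun ω : (Bits k → Bits (F.sampleCoins.eval n)) ×
        (Bits k → Bits (F.invCoins.eval n)) =>
      (fun m => F.f n pk (F.sample n (ω.1 m))) = H ∧
        ∀ m : ↥M, F.inv n sk (H m) (ω.2 m) = τ m) =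
      ∏ m, v m (hashSignEquiv M (H, τ) m) := by
    intro H τ
    rw [← prob_forall, ← prob_equiv (Equiv.arrowProdEquivProdArrow _ _ _)]
    refine prob_congr fun Oc => ⟨fun ⟨h₁, h₂⟩ m => ⟨congrFun h₁ m, fun hm => h₂ ⟨m, hm⟩⟩,
      fun h => ⟨funext fun m => (h m).1, fun m => (h m).2 m.2⟩⟩
  have hu₁ : ∀ m, ∑ p, u m p = 1 := fun m => by
    rw [← sum_prob_eq fun r => (F.f n pk (F.sample n r), fun _ : m ∈ M => F.sample n r)]
    refine Finset.sum_congr rfl fun p _ => prob_congr fun r => ?_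
    exact ⟨fun ⟨h₁, h₂⟩ => Prod.ext h₁ (funext h₂),
      fun h => ⟨congrArg Prod.fst h, fun hm => congrFun (congrArg Prod.snd h) hm⟩⟩
  have hv₁ : ∀ m, ∑ p, v m p = 1 := fun m => by
    rw [← sum_prob_eq fun ω : Bits (F.sampleCoins.eval n) × Bits (F.invCoins.eval n) =>
      (F.f n pk (F.sample n ω.1), fun _ : m ∈ M => F.inv n sk (F.f n pk (F.sample n ω.1)) ω.2)]
    refine Finset.sum_congr rfl fun p _ => prob_congr fun ω => ?_
    constructor
    · rintro ⟨h₁, h₂⟩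
      exact Prod.ext h₁ (funext fun hm => by simpa only [h₁] using h₂ hm)
    · rintro rfl
      exact ⟨rfl, fun _ => rfl⟩
  have hm : ∀ m, ∑ p, |u m p - v m p| ≤ if m ∈ M then ε else 0 := by
    intro m
    have hv' : ∀ p, v m p = prob (fun r => F.f n pk (F.sample n r) = p.1) *
        prob (fun ρ => ∀ hm : m ∈ M, F.inv n sk p.1 ρ = p.2 hm) := fun p =>
      prob_prod_and (fun r => F.f n pk (F.sample n r) = p.1)
        fun ρ => ∀ hm : m ∈ M, F.inv n sk p.1 ρ = p.2 hm
    by_cases hm : m ∈ M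
    · rw [if_pos hm]
      refine le_of_eq_of_le ?_ (sum_abs_sample_sub_inv_le h)
      rw [Fintype.sum_prod_type]
      refine Finset.sum_congr rfl fun y _ => ?_
      refine Fintype.sum_equiv ⟨fun x => x hm, fun x _ => x, fun _ => rfl, fun _ => rfl⟩ _ _
        fun x => ?_
      rw [hv']
      simp only [u, hm, forall_true_left, Equiv.coe_fn_mk]
      rfl
    · rw [if_neg hm]
      refine le_of_eq (Finset.sum_eq_zero fun p _ => ?_)
      rw [hv']
      simp [u, hm, prob_true]
  calc _ = ∑ p : (Bits k → Bits (F.ranLen n)) × (↥M → Bits (F.domLen n)),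
        |∏ m, u m (hashSignEquiv M p m) - ∏ m, v m (hashSignEquiv M p m)| := by
        rw [Fintype.sum_prod_type]
        simp only [hU, hV]
    _ = ∑ g : ∀ m, Bits (F.ranLen n) × (m ∈ M → Bits (F.domLen n)),
        |∏ m, u m (g m) - ∏ m, v m (g m)| :=
        Equiv.sum_comp (hashSignEquiv M) fun g => |∏ m, u m (g m) - ∏ m, v m (g m)|
    _ ≤ ∑ m, ∑ p, |u m p - v m p| :=
        sum_abs_prod_sub_prod_le (fun _ _ => prob_nonneg _) (fun _ _ => prob_nonneg _) hu₁ hv₁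
    _ ≤ ∑ m, (if m ∈ M then ε else 0) := Finset.sum_le_sum fun m _ => hm m
    _ = M.card * ε := by simp

end Sign

/-! ### The reduction is history-free -/

section HistoryFree

variable (F : PSF) (ℓ : Polynomial ℕ)

theorem psfReduction_sign_close : ∃ ε : ℕ → ℝ, Negligible ε ∧
    ∀ n (c : Bits ((fdhPSF F ℓ).genCoins n)) (M : Finset (Bits ((fdhPSF F ℓ).msgLen n))),
      ∑ H : Bits ((fdhPSF F ℓ).hIn n) → Bits ((fdhPSF F ℓ).hOut n),
        ∑ τ : ↥M → Bits ((fdhPSF F ℓ).sigLen n),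
        |prob (fun Oc : (psfReduction F ℓ).COracle n =>
            (psfReduction F ℓ).simHash n ((psfReduction F ℓ).instOf n ((fdhPSF F ℓ).gen n c).2) Oc
              = H ∧
            ∀ m : ↥M, (psfReduction F ℓ).sign n Oc m ((psfReduction F ℓ).simSt n
              ((psfReduction F ℓ).instOf n ((fdhPSF F ℓ).gen n c).2)) = some (τ m)) -
          prob (fun ω : (psfReduction F ℓ).COracle n ×
              (Bits ((fdhPSF F ℓ).msgLen n) → Bits ((fdhPSF F ℓ).signCoins n)) =>
            (psfReduction F ℓ).simHash n ((psfReduction F ℓ).instOf n ((fdhPSF F ℓ).gen n c).2) ω.1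
              = H ∧
            (∀ m : ↥M, (psfReduction F ℓ).sign n ω.1 m ((psfReduction F ℓ).simSt n
              ((psfReduction F ℓ).instOf n ((fdhPSF F ℓ).gen n c).2)) ≠ none) ∧
            ∀ m : ↥M, (fdhPSF F ℓ).sign n H ((fdhPSF F ℓ).gen n c).1 m (ω.2 m) = τ m)|
        ≤ M.card * ε n * prob (fun Oc : (psfReduction F ℓ).COracle n =>
            ∀ m : ↥M, (psfReduction F ℓ).sign n Oc m ((psfReduction F ℓ).simSt n
              ((psfReduction F ℓ).instOf n ((fdhPSF F ℓ).gen n c).2)) ≠ none) := by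
  obtain ⟨ε, hε, h⟩ := F.inv_close
  refine ⟨ε, hε, fun n c M => ?_⟩
  have hone : prob (fun Oc : (psfReduction F ℓ).COracle n =>
      ∀ m : ↥M, (psfReduction F ℓ).sign n Oc m ((psfReduction F ℓ).simSt n
        ((psfReduction F ℓ).instOf n ((fdhPSF F ℓ).gen n c).2)) ≠ none) = 1 :=
    prob_eq_one fun Oc m => Option.some_ne_none _
  rw [hone, mul_one]
  refine le_of_eq_of_le ?_ (sum_abs_sign_sub_le (c := c) (h n c) M)
  refine Finset.sum_congr rfl fun H _ => Finset.sum_congr rfl fun τ _ => ?_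
  congr 2
  · exact prob_congr fun Oc => and_congr_right fun _ =>
      forall_congr' fun m => Option.some_inj
  · exact prob_congr fun ω => and_congr_right fun _ =>
      and_iff_right fun m => Option.some_ne_none _

/-- The variational distance of the simulated and the uniform hash value of a single message. -/
theorem PSF.sum_f_sample_uniform_close {F : PSF} {n : ℕ} {c : Bits (F.genCoins.eval n)} {ε : ℝ}
    (h : ∑ y ∈ F.ran n, |prob (fun r => F.f n (F.gen n c).2 (F.sample n r) = y) -
      1 / ((F.ran n).card : ℝ)| ≤ ε) :
    ∑ y, |prob (fun r => F.f n (F.gen n c).2 (F.sample n r) = y) -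
      prob (fun z : ↥(F.ran n) => (z : Bits (F.ranLen n)) = y)| ≤ ε := by
  classical
  refine le_of_eq_of_le ?_ h
  rw [← Finset.sum_subset (Finset.subset_univ (F.ran n))]
  · refine Finset.sum_congr rfl fun y hy => ?_
    have hz : prob (fun z : ↥(F.ran n) => (z : Bits (F.ranLen n)) = y) =
        prob fun z : ↥(F.ran n) => z = ⟨y, hy⟩ :=
      prob_congr fun z => (Subtype.ext_iff (a2 := ⟨y, hy⟩)).symm
    rw [hz, prob_eq_self, Fintype.card_coe]
  · intro y _ hy
    have hz : prob (fun z : ↥(F.ran n) => (z : Bits (F.ranLen n)) = y) = 0 := by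
      rw [← prob_false (Ω := ↥(F.ran n))]
      exact prob_congr fun z => ⟨fun hz => hy (hz ▸ z.2), False.elim⟩
    rw [PSF.prob_f_sample_eq_zero hy, hz, sub_zero, abs_zero]

theorem psfReduction_rand_indist (i : ∀ n, Bits ((collisionProblem F).coins n)) :
    QIndistinguishable (a := (fdhPSF F ℓ).hIn) (b := (fdhPSF F ℓ).hOut)
      (Ω := fun n => (psfReduction F ℓ).COracle n)
      (Ω' := fun n => Bits ((fdhPSF F ℓ).hIn n) → ↥((fdhPSF F ℓ).hRan n))
      (fun n Oc => (psfReduction F ℓ).simHash n ((collisionProblem F).inst n (i n)) Oc)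
      (fun _ H y => (H y : Bits _)) := by
  intro D
  obtain ⟨ε, hε, h⟩ := F.sample_uniform
  obtain ⟨p, hp⟩ := D.poly
  refine ((hε.sqrt.polynomial_mul p).polynomial_mul 8).of_nonneg_of_le
    (fun n => Finset.sum_nonneg fun _ _ => abs_nonneg _) fun n => ?_
  refine (sum_abs_outputProb_sub_le (fun r => F.f n (F.gen n (i n)).2 (F.sample n r))
    (fun z : ↥(F.ran n) => (z : Bits (F.ranLen n)))
    (PSF.sum_f_sample_uniform_close (h n (i n))) (D.circ n)).trans ?_
  simp only [Polynomial.eval_ofNat, Nat.cast_ofNat, mul_assoc]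
  gcongr
  exact (hp n).2

end HistoryFree

theorem mainTheorem5 (F : PSF) (ℓ : Polynomial ℕ) : (psfReduction F ℓ).IsHistoryFree where
  efficient := psfReduction_efficient F ℓ
  solver_efficient := psfReduction_solver_efficient F ℓ
  security A hA := psfReduction_security A hA
  start_instOf n pk := ⟨pk, rfl⟩
  instOf_close := by
    have h : ∀ n, ∑ x : Bits ((collisionProblem F).instLen n),
        |prob (fun c => (psfReduction F ℓ).instOf n ((fdhPSF F ℓ).gen n c).2 = x) -
          prob (fun i => (collisionProblem F).inst n i = x)| = 0 :=
      fun n => Finset.sum_eq_zero fun x _ => abs_eq_zero.2 (sub_self _)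
    simp only [h]
    exact Negligible.zero
  rand_indist := psfReduction_rand_indist F ℓ
  sign_valid n c Oc m σ h := by
    obtain rfl := Option.some_inj.1 h
    exact ⟨F.sample_mem n _, rfl⟩
  sign_close := psfReduction_sign_close F ℓ
  no_abort A := by
    have h : ∀ n, (psfReduction F ℓ).simProb A n
        (fun x Oc r => (psfReduction F ℓ).NoAbort A n x Oc r) = 1 :=
      fun n => prob_eq_one fun ω => psfReduction_noAbort F ℓ A n _ _ _
    simp only [h]
    exact Negligible.not_of_tendsto_one tendsto_const_nhds
  finish_solves A := psfReduction_finish_solves A
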